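/- Let $\mathcal A$ be an irreducible supersolvable simplicial arrangement of hyperplanes (i.e. a finite set of linear hyperplanes) in a $3$-dimensional real vector space $V$. Let $L(\mathcal A)$ denote its intersection lattice (all intersections of subsets of $\mathcal A$, ordered by reverse inclusion), and for $X\in L(\mathcal A)$ let $\mathcal A_X=\{H\in\mathcal A\mid X\subseteq H\}$. Call $X\in L(\mathcal A)$ modular if $X+Y\in L(\mathcal A)$ for all $Y\in L(\mathcal A)$. An arrangement in an $\ell$-dimensional space is supersolvable if the intersection of its hyperplanes is $0$ and there is a chain $V=X_0\supsetneq X_1\supsetneq\dots\supsetneq X_\ell=0$ of modular elements of its intersection lattice. A real arrangement is simplicial if every connected component of $V\setminus\bigcup_{H\in\mathcal A}H$ is the set of positive linear combinations of a basis of $V$. It is reducible if $V=V_1\oplus V_2$ with $V_1,V_2\ne0$ and there are arrangements $\mathcal A_1$ in $V_1$ and $\mathcal A_2$ in $V_2$ with $\mathcal A=\{H\oplus V_2\mid H\in\mathcal A_1\}\cup\{V_1\oplus H\mid H\in\mathcal A_2\}$, and irreducible otherwise. Write $\mathcal A\sim_L\mathcal B$ if $L(\mathcal A)\cong L(\mathcal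 B)$. For $n\ge 3$ let $\mathcal A(2n,1)$ be the arrangement in $\mathbb R^3$ of the $2n$ planes orthogonal to the vectors $(-\sin\frac{k\pi}{n},\cos\frac{k\pi}{n},0)$, $0\le k\le n-1$, and $(\cos\frac{(2j-1)\pi}{n},\sin\frac{(2j-1)\pi}{n},1)$, $1\le j\le n$. For $m\ge2$ let $\mathcal A(4m+1,1)=\mathcal A(4m,1)\cup\{(0,0,1)^\perp\}$. Let $X\in L(\mathcal A)$ be a modular element of codimension $2$, and set $n:=|\mathcal A_X|$. Let $\mathcal B\subseteq\mathcal A$ be a subarrangement with $\mathcal B_X=\mathcal A_X$ and $\mathcal B\sim_L\mathcal A(2n,1)$. Then 1. $|\mathcal A\setminus\mathcal B|\le 1$, and 2. if $\mathcal A=\mathcal B\,\dot\cup\,\{J\}$ for some hyperplane $J$, then $n$ is even and $\mathcal A\sim_L\mathcal A(4\tfrac n2+1,1)$. -/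

import Mathlib

/-- A (central) hyperplane arrangement in `V`: a finite set of hyperplanes, that is, of linear
subspaces of codimension one (the coatoms of the lattice of subspaces). -/
structure Arrangement (V : Type*) [AddCommGroup V] [Module ℝ V] where
  hyperplanes : Set (Submodule ℝ V)
  finite_hyperplanes : hyperplanes.Finite
  isCoatom_of_mem : ∀ H ∈ hyperplanes, IsCoatom H

namespace Arrangement

section Lattice

variable {V : Type*} [AddCommGroup V] [Module ℝ V]

/-- The underlying set of the intersection lattice `L(A)`: all intersections of subsets of `A`
(the empty intersection is `V`). -/
def flats (A : Arrangement V) : Set (Submodule ℝ V) :=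
  {X | ∃ S : Set (Submodule ℝ V), S ⊆ A.hyperplanes ∧ X = sInf S}

/-- The intersection lattice `L(A)`, partially ordered by reverse inclusion. -/
abbrev IntersectionLattice (A : Arrangement V) : Type _ := (A.flats)ᵒᵈ

/-- `L_q(A)`: the elements of `L(A)` of rank (codimension) `q`. -/
def flatsOfRank (A : Arrangement V) (q : ℕ) : Set (Submodule ℝ V) :=
  {X | X ∈ A.flats ∧ Module.finrank ℝ (V ⧸ X) = q}

/-- The center `T(A)`: the intersection of all hyperplanes of `A`. -/
def center (A : Arrangement V) : Submodule ℝ V := sInf A.hyperplanes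

/-- `A` is essential if its rank, the codimension of the center, is `dim V`. -/
def IsEssential (A : Arrangement V) : Prop :=
  Module.finrank ℝ (V ⧸ A.center) = Module.finrank ℝ V

/-- The localization `A_X = {H ∈ A | X ⊆ H}`. -/
def localization (A : Arrangement V) (X : Submodule ℝ V) : Arrangement V where
  hyperplanes := {H | H ∈ A.hyperplanes ∧ X ≤ H}
  finite_hyperplanes := A.finite_hyperplanes.subset fun _ h => h.1
  isCoatom_of_mem := fun H h => A.isCoatom_of_mem H h.1

/-- `X ∈ L(A)` is modular if `X + Y ∈ L(A)` for all `Y ∈ L(A)`. -/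
def IsModular (A : Arrangement V) (X : Submodule ℝ V) : Prop :=
  X ∈ A.flats ∧ ∀ Y ∈ A.flats, X ⊔ Y ∈ A.flats

/-- An essential arrangement in an `ℓ`-dimensional space is supersolvable if there is a chain
`V = X₀ < X₁ < ⋯ < X_ℓ = T(A)` of modular elements of `L(A)` (in the order of `L(A)`, which is
reverse inclusion). -/
def IsSupersolvable (A : Arrangement V) : Prop :=
  A.IsEssential ∧
    ∃ X : Fin (Module.finrank ℝ V + 1) → Submodule ℝ V,
      StrictAnti X ∧ X 0 = ⊤ ∧ X (Fin.last _) = A.center ∧ ∀ i, A.IsModular (X i)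

/-- `A` is reducible if it is a product `A₁ × A₂` of arrangements in nonzero spaces, that is, if
`V = V₁ ⊕ V₂` with `V₁, V₂ ≠ 0`, and there are arrangements `A₁` in `V₁` and `A₂` in `V₂` with
`A = {H₁ ⊕ V₂ | H₁ ∈ A₁} ∪ {V₁ ⊕ H₂ | H₂ ∈ A₂}`. -/
def IsReducible (A : Arrangement V) : Prop :=
  ∃ V₁ V₂ : Submodule ℝ V, IsCompl V₁ V₂ ∧ V₁ ≠ ⊥ ∧ V₂ ≠ ⊥ ∧
    ∃ (A₁ : Arrangement V₁) (A₂ : Arrangement V₂),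
      A.hyperplanes =
        (fun H₁ : Submodule ℝ V₁ => H₁.map V₁.subtype ⊔ V₂) '' A₁.hyperplanes ∪
        (fun H₂ : Submodule ℝ V₂ => V₁ ⊔ H₂.map V₂.subtype) '' A₂.hyperplanes

def IsIrreducible (A : Arrangement V) : Prop := ¬ A.IsReducible

/-- Lattice equivalence `A ∼_L B`: the intersection lattices are isomorphic. -/
def LatticeEquiv {W : Type*} [AddCommGroup W] [Module ℝ W]
    (A : Arrangement V) (B : Arrangement W) : Prop :=
  Nonempty (A.IntersectionLattice ≃o B.IntersectionLattice)

end Lattice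

section Chambers

variable {V : Type*} [NormedAddCommGroup V] [NormedSpace ℝ V]

/-- The complement `V \ ⋃_{H ∈ A} H`. -/
def complement (A : Arrangement V) : Set V := {v | ∀ H ∈ A.hyperplanes, v ∉ H}

/-- The chambers of `A`: the connected components of its complement. -/
def chambers (A : Arrangement V) : Set (Set V) :=
  {K | ∃ v ∈ A.complement, K = connectedComponentIn A.complement v}

/-- An open simplicial cone: the set of all positive linear combinations of a basis of `V`. -/
def IsOpenSimplicialCone (K : Set V) : Prop :=
  ∃ b : Module.Basis (Fin (Module.finrank ℝ V)) ℝ V, K = {v | ∀ i, 0 < b.repr v i}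

/-- `A` is simplicial if every chamber is an open simplicial cone. -/
def IsSimplicial (A : Arrangement V) : Prop :=
  ∀ K ∈ A.chambers, IsOpenSimplicialCone K

end Chambers

section Series

/-- The hyperplane `a^⊥ = {x | a₀ x₀ + a₁ x₁ + a₂ x₂ = 0}` in `ℝ³`. -/
def perp (a : Fin 3 → ℝ) : Submodule ℝ (Fin 3 → ℝ) :=
  LinearMap.ker (Fintype.linearCombination ℝ a)

theorem mem_perp (a x : Fin 3 → ℝ) : x ∈ perp a ↔ a 0 * x 0 + a 1 * x 1 + a 2 * x 2 = 0 := by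
  simp [perp, Fintype.linearCombination_apply, Fin.sum_univ_three, mul_comm]

theorem isCoatom_perp (a : Fin 3 → ℝ) (ha : a ≠ 0) : IsCoatom (perp a) := by
  apply LinearMap.isCoatom_ker_of_surjective
  apply LinearMap.surjective
  intro h
  apply ha
  funext i
  have := LinearMap.congr_fun h (Pi.single i 1)
  simpa [Fintype.linearCombination_apply, Pi.single_apply] using this

/-- `c_n(m) = cos (2πm / 2n)`. -/
noncomputable def cosN (n m : ℕ) : ℝ := Real.cos (2 * Real.pi * m / (2 * n))

/-- `s_n(m) = sin (2πm / 2n)`. -/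
noncomputable def sinN (n m : ℕ) : ℝ := Real.sin (2 * Real.pi * m / (2 * n))

/-- The arrangement `A(2n,1)` in `ℝ³` (used for `n ≥ 3`): the hyperplanes
`(-s_n(k), c_n(k), 0)^⊥` for `k = 0, …, n-1` and `(c_n(m), s_n(m), 1)^⊥` for
`m = 1, 3, …, 2n-1`. -/
noncomputable def A2n (n : ℕ) : Arrangement (Fin 3 → ℝ) where
  hyperplanes :=
    Set.range (fun k : Fin n => perp ![-sinN n k, cosN n k, 0]) ∪
    Set.range (fun j : Fin n => perp ![cosN n (2 * j + 1), sinN n (2 * j + 1), 1])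
  finite_hyperplanes := (Set.finite_range _).union (Set.finite_range _)
  isCoatom_of_mem := by
    rintro H (⟨k, rfl⟩ | ⟨j, rfl⟩)
    · apply isCoatom_perp
      intro h
      have h0 : sinN n k = 0 := by simpa using congrFun h 0
      have h1 : cosN n k = 0 := by simpa using congrFun h 1
      have := Real.sin_sq_add_cos_sq (2 * Real.pi * (k : ℕ) / (2 * n))
      rw [sinN] at h0
      rw [cosN] at h1
      rw [h0, h1] at this
      norm_num at this
    · apply isCoatom_perp
      intro h
      simpa using congrFun h 2

/-- The arrangement `A(4m+1,1) = A(4m,1) ∪ {(0,0,1)^⊥}` in `ℝ³` (used for `m ≥ 2`). -/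
noncomputable def A4mAddOne (m : ℕ) : Arrangement (Fin 3 → ℝ) where
  hyperplanes := insert (perp ![0, 0, 1]) (A2n (2 * m)).hyperplanes
  finite_hyperplanes := (A2n (2 * m)).finite_hyperplanes.insert _
  isCoatom_of_mem := by
    rintro H (rfl | hH)
    · apply isCoatom_perp
      intro h
      simpa using congrFun h 2
    · exact (A2n (2 * m)).isCoatom_of_mem H hH

end Series

end Arrangement

/-! Let `x` span the modular line `X`. A hyperplane not containing `x` is the kernel of a unique
functional `h` with `h x = 1`, so the hyperplanes off `X` become points of an affine plane in the
dual space. For two such points `h`, `k`, the subspace `ker h ⊓ ker k + X` equals `ker (h - k)`.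
Modularity therefore says that every line joining two of the points has one of `n` directions,
namely those given by the `n` hyperplanes through `X`.

In `A(2n,1)` the planes off the axis are indexed by `ℤ/n` so that the `i`-th and `j`-th meet on a
mirror depending only on `i + j`. The lattice isomorphism carries this to `B`: its `n` points `p i`
have `p i - p j` in a direction determined by `i + j` (`Labelling`). Such points form an affinely
regular `n`-gon, `p i = c + G (ψ i)` with `ψ` an injective character of `ℤ/n`
(`exists_addChar_of_parallel`), because the edge vectors satisfy a linear recurrence with constant
coefficient, and periodicity makes it elliptic.

A hyperplane of `A` outside `B` is a further point from which every vertex is seen in a direction of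
a side or diagonal. Summing the equations of these lines over all vertices forces the point to be
the centre `c`, and then `n` is even (`eq_zero_and_even_of_directions`). So there is at most one
such hyperplane. The functionals `G 1`, `G I`, `c`, after a rotation by half a step, serve as linear
coordinates identifying `B ∪ {ker c}` with `A(4m+1,1)`, where `m = n/2`.

Two small cases need care. For `n = 2`, an extra hyperplane would make `A` reducible. For `n = 3`
the axis of `A(6,1)` is not singled out by the number of hyperplanes through it, so the labelling is
built by hand. -/

/-! ### Affinely regular polygons in the complex plane -/

section RegularPolygon

open Function

variable {E : Type*} [AddCommGroup E] [Module ℝ E]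

/-- The real-linear map `ℂ → E` with `1 ↦ u` and `I ↦ v`. -/
noncomputable def complexLift (u v : E) : ℂ →ₗ[ℝ] E :=
  Complex.reLm.smulRight u + Complex.imLm.smulRight v

theorem complexLift_apply (u v : E) (z : ℂ) : complexLift u v z = z.re • u + z.im • v := by
  simp [complexLift]

theorem complexLift_injective {u v : E} (h : LinearIndependent ℝ ![u, v]) :
    Injective (complexLift u v) := by
  rw [← LinearMap.ker_eq_bot, LinearMap.ker_eq_bot']
  intro z hz
  rw [complexLift_apply] at hz
  obtain ⟨h1, h2⟩ := LinearIndependent.pair_iff.1 h _ _ hz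
  exact Complex.ext h1 h2

/-- A periodic solution of `a (i + 2) = k a (i + 1) - a i` with independent initial values is
elliptic: the characteristic polynomial has no real root. -/
theorem im_ne_zero_of_periodic_recurrence {a : ℕ → E} {n : ℕ} (hn : n ≠ 0) {k : ℝ}
    (hrec : ∀ i, a (i + 2) = k • a (i + 1) - a i) (h0 : a n = a 0) (h1 : a (n + 1) = a 1)
    (hind : LinearIndependent ℝ ![a 0, a 1]) {z : ℂ} (hz : z ^ 2 = k * z - 1) : z.im ≠ 0 := by
  intro him
  obtain ⟨r, rfl⟩ : ∃ r : ℝ, z = r := ⟨z.re, Complex.ext rfl (by simpa using him)⟩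
  have hr : r ^ 2 = k * r - 1 := by exact_mod_cast hz
  -- `s` is the other root of the characteristic polynomial. Factoring out the root `r` leaves the
  -- geometric sequence `a (i + 1) - r • a i` of ratio `s`, and periodicity gives `s ^ n = 1`.
  set s := k - r with hs
  have hrs : r * s = 1 := by rw [hs]; linarith
  have hd : a 1 - r • a 0 ≠ 0 := by
    intro h
    have := LinearIndependent.pair_iff.1 hind (-r) 1 (by rw [← h]; module)
    exact one_ne_zero this.2
  have hpow : ∀ i, a (i + 1) - r • a i = s ^ i • (a 1 - r • a 0) := by
    intro i
    induction i with
    | zero => simp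
    | succ i ih =>
      rw [pow_succ', mul_smul, ← ih, hrec]
      have : s • (a (i + 1) - r • a i) = s • a (i + 1) - (r * s) • a i := by module
      rw [this, hrs, hs]
      module
  have hsn : s ^ n = 1 := by
    have h := hpow n
    rw [h0, h1] at h
    have h' : (s ^ n - 1) • (a 1 - r • a 0) = 0 := by rw [sub_smul, ← h]; module
    rcases smul_eq_zero.1 h' with h' | h'
    · linarith
    · exact absurd h' hd
  -- A real root of unity is `1` or `-1`, so the two roots coincide. A double root makes `s ^ i • a
  -- i` grow linearly, against periodicity.
  have hs2 : s * s = 1 := by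
    have : |s| = 1 := by
      rw [← pow_eq_one_iff_of_nonneg (abs_nonneg s) hn, ← abs_pow, hsn, abs_one]
    rw [← abs_mul_abs_self, this, one_mul]
  have hrs' : r = s := by
    have : r * s * s = s := by rw [hrs, one_mul]
    rwa [mul_assoc, hs2, mul_one] at this
  have hlin : ∀ i : ℕ, s ^ i • a i = a 0 + ((i : ℝ) * s) • (a 1 - r • a 0) := by
    intro i
    induction i with
    | zero => simp
    | succ i ih =>
      have h := hpow i
      have h' : a (i + 1) = s • a i + s ^ i • (a 1 - r • a 0) := by
        rw [← h, hrs']; module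
      have e1 : s ^ (i + 1) * s = s ^ i := by rw [pow_succ, mul_assoc, hs2, mul_one]
      have e2 : s ^ (i + 1) * s ^ i = s := by
        rw [pow_succ, mul_right_comm, ← mul_pow, hs2, one_pow, one_mul]
      rw [h', smul_add, smul_smul, smul_smul, e1, e2, ih]
      push_cast
      module
  have h := hlin n
  rw [hsn, h0, one_smul, left_eq_add, smul_eq_zero] at h
  rcases h with h | h
  · rcases mul_eq_zero.1 h with h | h
    · exact hn (by exact_mod_cast h)
    · rw [h] at hs2; norm_num at hs2
  · exact hd h

/-- Points `p i` indexed by `ℤ/n`, for which the direction of `p i - p j` depends only on `i + j`,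
are the vertices of an affinely regular `n`-gon. -/
theorem exists_addChar_of_parallel {n : ℕ} [NeZero n] (hn : 3 ≤ n) (p : ZMod n → E)
    (hinj : Injective p)
    (hpar : ∀ i j k l, k ≠ l → i + j = k + l → ∃ t : ℝ, p i - p j = t • (p k - p l))
    (hind : ∀ i, LinearIndependent ℝ ![p (i + 1) - p i, p (i + 2) - p (i + 1)]) :
    ∃ (ψ : AddChar (ZMod n) ℂ) (c : E) (G : ℂ →ₗ[ℝ] E),
      Injective ψ ∧ Injective G ∧ ∀ i, p i = c + G (ψ i) := by
  have hne1 : (1 : ZMod n) ≠ 0 := by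
    have : Fact (1 < n) := ⟨by omega⟩
    exact one_ne_zero
  have hne2 : (2 : ZMod n) ≠ 0 := by
    intro h
    have : ((2 : ℕ) : ZMod n) = 0 := by exact_mod_cast h
    rw [ZMod.natCast_eq_zero_iff] at this
    exact absurd (Nat.le_of_dvd two_pos this) (by omega)
  -- The outer diagonal from `i` to `i + 3` is parallel to the middle edge, because the index sums
  -- agree.
  have step : ∀ i : ZMod n, ∃ k : ℝ,
      p (i + 3) - p (i + 2) = k • (p (i + 2) - p (i + 1)) - (p (i + 1) - p i) := by
    intro i
    obtain ⟨t, ht⟩ := hpar (i + 3) i (i + 2) (i + 1)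
      (by intro h; apply hne1; linear_combination h) (by ring)
    refine ⟨t - 1, ?_⟩
    rw [sub_smul, ← ht]
    module
  choose k hk using step
  -- The parallel chords from `i` to `i + 4` and from `i + 1` to `i + 3` have ratio `t`. Comparing
  -- coefficients on the two independent middle edges gives `k i = t = k (i + 1)`.
  have hconst : ∀ i, k (i + 1) = k i := by
    intro i
    obtain ⟨t, ht⟩ := hpar (i + 4) i (i + 3) (i + 1)
      (by intro h; apply hne2; linear_combination h) (by ring)
    have h1 := hk i
    have h2 := hk (i + 1)
    rw [show i + 1 + 3 = i + 4 by ring, show i + 1 + 2 = i + 3 by ring,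
      show i + 1 + 1 = i + 2 by ring] at h2
    have hli := hind (i + 1)
    rw [show i + 1 + 2 = i + 3 by ring, show i + 1 + 1 = i + 2 by ring] at hli
    have := LinearIndependent.pair_iff.1 hli (k i - t) (k (i + 1) - t) (by
      have e : (k i - t) • (p (i + 2) - p (i + 1)) + (k (i + 1) - t) • (p (i + 3) - p (i + 2))
        = k i • (p (i + 2) - p (i + 1)) + k (i + 1) • (p (i + 3) - p (i + 2))
          - t • (p (i + 3) - p (i + 1)) := by module
      rw [e, ← ht]
      have h2' : k (i + 1) • (p (i + 3) - p (i + 2))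
        = p (i + 4) - p (i + 3) + (p (i + 2) - p (i + 1)) := by rw [h2]; module
      rw [h2']
      have h1' : k i • (p (i + 2) - p (i + 1))
        = p (i + 3) - p (i + 2) + (p (i + 1) - p i) := by rw [h1]; module
      rw [h1']
      module)
    linarith [this.1, this.2]
  have hk0 : ∀ i : ℕ, k i = k 0 := by
    intro i
    induction i with
    | zero => simp
    | succ i ih => push_cast; rw [hconst, ih]
  set a : ℕ → E := fun i => p (i + 1) - p i with ha
  have hrec : ∀ i, a (i + 2) = k 0 • a (i + 1) - a i := by
    intro i
    have h := hk i
    rw [hk0] at h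
    simp only [ha]
    push_cast
    rw [show (i : ZMod n) + 2 + 1 = i + 3 by ring, show (i : ZMod n) + 1 + 1 = i + 2 by ring]
    exact h
  have han : a n = a 0 := by simp [ha]
  have han1 : a (n + 1) = a 1 := by simp [ha]
  have hind0 : LinearIndependent ℝ ![a 0, a 1] := by
    have := hind 0
    simp only [zero_add] at this
    simpa [ha, one_add_one_eq_two] using this
  obtain ⟨s, hs⟩ := IsAlgClosed.exists_pow_nat_eq ((k 0 : ℂ) ^ 2 - 4) two_pos
  obtain ⟨z, hz⟩ : ∃ z : ℂ, z ^ 2 = k 0 * z - 1 := by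
    refine ⟨(k 0 + s) / 2, ?_⟩
    linear_combination hs / 4
  have him := im_ne_zero_of_periodic_recurrence (NeZero.ne n) hrec han han1 hind0 hz
  -- Chosen so that `G 1 = a 0` and `G z = a 1`. The recurrence then gives `G (z ^ i) = a i`, and
  -- the vertices follow by summing a geometric series.
  set G := complexLift (a 0) (z.im⁻¹ • (a 1 - z.re • a 0)) with hG
  have hGinj : Injective G := by
    apply complexLift_injective
    rw [LinearIndependent.pair_iff] at hind0 ⊢
    intro x y hxy
    obtain ⟨h1, h2⟩ := hind0 (x - y * z.im⁻¹ * z.re) (y * z.im⁻¹) (by rw [← hxy]; module)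
    have hy : y = 0 := by simpa [him] using h2
    refine ⟨by simpa [hy] using h1, hy⟩
  have hGa : ∀ i, G (z ^ i) = a i ∧ G (z ^ (i + 1)) = a (i + 1) := by
    intro i
    induction i with
    | zero =>
      simp [hG, complexLift_apply, smul_smul, mul_inv_cancel₀ him]
    | succ i ih =>
      refine ⟨ih.2, ?_⟩
      have e : z ^ (i + 1 + 1) = (k 0) • z ^ (i + 1) - z ^ i := by
        rw [Complex.real_smul]
        linear_combination z ^ i * hz
      rw [e, map_sub, map_smul, ih.1, ih.2]
      exact (hrec i).symm
  have hzn : z ^ n = 1 := by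
    apply hGinj
    rw [(hGa n).1, han, ← (hGa 0).1, pow_zero]
  have hz1 : z - 1 ≠ 0 := by
    intro h
    apply him
    rw [sub_eq_zero.1 h, Complex.one_im]
  have hp : ∀ i : ℕ, p i = (p 0 - G (z - 1)⁻¹) + G ((z - 1)⁻¹ * z ^ i) := by
    intro i
    induction i with
    | zero => simp
    | succ i ih =>
      have e : (z - 1)⁻¹ * z ^ (i + 1) = (z - 1)⁻¹ * z ^ i + z ^ i := by
        field_simp
        ring
      rw [e, map_add, ← add_assoc, ← ih, (hGa i).1]
      simp [ha]
  have hp' : ∀ i : ZMod n, p i = (p 0 - G (z - 1)⁻¹) +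
      (G ∘ₗ LinearMap.mulLeft ℝ (z - 1)⁻¹) (AddChar.zmodChar n hzn i) := by
    intro i
    have := hp i.val
    rwa [ZMod.natCast_zmod_val] at this
  refine ⟨AddChar.zmodChar n hzn, p 0 - G (z - 1)⁻¹, G ∘ₗ LinearMap.mulLeft ℝ (z - 1)⁻¹,
    ?_, ?_, hp'⟩
  · intro i j hij
    apply hinj
    rw [hp' i, hp' j, hij]
  · rw [LinearMap.coe_comp]
    exact hGinj.comp (mul_right_injective₀ (inv_ne_zero hz1))

/-- If all the lines through `w` and a vertex of the regular `n`-gon have the direction of an edge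
or a diagonal, then `w` is the centre and `n` is even. -/
theorem eq_zero_and_even_of_directions {n : ℕ} [NeZero n] (hn : 3 ≤ n)
    {ψ : AddChar (ZMod n) ℂ} (hψ : Injective ψ) {w : ℂ} {f : ZMod n → ZMod n}
    (hf : ∀ i, ∃ (t : ℝ) (j k : ZMod n), j + k = f i ∧ w - ψ i = t * (ψ j - ψ k))
    (hinv : ∀ i, f (f i - i) = f i) : w = 0 ∧ Even n := by
  have hne2 : (2 : ZMod n) ≠ 0 := by
    intro h
    have : ((2 : ℕ) : ZMod n) = 0 := by exact_mod_cast h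
    rw [ZMod.natCast_eq_zero_iff] at this
    exact absurd (Nat.le_of_dvd two_pos this) (by omega)
  have hstar : ∀ i, starRingEnd ℂ (ψ i) * ψ i = 1 := by
    intro i
    rw [← AddChar.map_neg_eq_conj, ← AddChar.map_add_eq_mul, neg_add_cancel,
      AddChar.map_zero_eq_one]
  -- A chord `d = ψ j - ψ k` of the unit circle satisfies `d + ψ (j + k) * conj d = 0`, and so does
  -- each real multiple of it. With `d = w - ψ i` this is the equation of the line through `ψ i` of
  -- direction `f i`.
  have key : ∀ i, w + ψ (f i) * starRingEnd ℂ w = ψ i + ψ (f i - i) := by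
    intro i
    obtain ⟨t, j, k, hjk, h⟩ := hf i
    have hc := congrArg (starRingEnd ℂ) h
    simp only [map_sub, map_mul, Complex.conj_ofReal] at hc
    have e1 : ψ (f i) = ψ i * ψ (f i - i) := by
      rw [← AddChar.map_add_eq_mul]; congr 1; ring
    have e2 : ψ (f i) = ψ j * ψ k := by rw [← AddChar.map_add_eq_mul, hjk]
    have hi := hstar i
    have hj := hstar j
    have hk := hstar k
    linear_combination h + ψ (f i) * hc + starRingEnd ℂ (ψ i) * e1 + ψ (f i - i) * hi
      + (t : ℂ) * (starRingEnd ℂ (ψ j) - starRingEnd ℂ (ψ k)) * e2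
      + (t : ℂ) * ψ k * hj - (t : ℂ) * ψ j * hk
  have hψ1 : ψ ≠ 1 := by
    intro h
    apply hne2
    apply hψ
    rw [h]
    simp
  have hsum : ∑ i, ψ i = 0 := AddChar.sum_eq_zero_of_ne_one hψ1
  have hginv : Function.Involutive (fun i => f i - i) := by
    intro i
    change f (f i - i) - (f i - i) = i
    rw [hinv]
    ring
  have hsum' : ∑ i, ψ (f i - i) = 0 := by
    rw [← hsum]
    exact Equiv.sum_comp hginv.toPerm ψ
  -- Both `i` and `f i - i` run over all of `ℤ/n`, and the vertices sum to zero.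
  have htot : ∑ i, (w + ψ (f i) * starRingEnd ℂ w) = 0 := by
    rw [Finset.sum_congr rfl (fun i _ => key i), Finset.sum_add_distrib, hsum, hsum', add_zero]
  have hw : w = 0 := by
    by_contra hw
    -- After division by `w`, the sum consists of terms `1 + u` with `|u| = 1`. Their real parts are
    -- nonnegative with sum zero, so every `u` is `-1`. Hence `f` is constant.
    have hu : ∀ i, ‖ψ (f i) * starRingEnd ℂ w / w‖ = 1 := by
      intro i
      rw [norm_div, norm_mul, AddChar.norm_apply, one_mul, RCLike.norm_conj,
        div_self (norm_ne_zero_iff.2 hw)]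
    have hre : ∑ i, (1 + (ψ (f i) * starRingEnd ℂ w / w).re) = 0 := by
      have h : ∑ i, (1 + ψ (f i) * starRingEnd ℂ w / w) = 0 := by
        rw [← zero_div w, ← htot, Finset.sum_div]
        refine Finset.sum_congr rfl fun i _ => ?_
        field_simp
      have := congrArg Complex.re h
      simpa using this
    have hnonneg : ∀ i, 0 ≤ 1 + (ψ (f i) * starRingEnd ℂ w / w).re := by
      intro i
      have := (abs_le.1 (Complex.abs_re_le_norm (ψ (f i) * starRingEnd ℂ w / w))).1
      rw [hu] at this
      linarith
    have hzero := (Finset.sum_eq_zero_iff_of_nonneg (fun i _ => hnonneg i)).1 hre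
    have hneg : ∀ i, ψ (f i) * starRingEnd ℂ w / w = -1 := by
      intro i
      have h1 : (ψ (f i) * starRingEnd ℂ w / w).re = -1 := by
        linarith [hzero i (Finset.mem_univ i)]
      have h2 := Complex.sq_norm (ψ (f i) * starRingEnd ℂ w / w)
      rw [hu, Complex.normSq_apply, h1] at h2
      have h3 : (ψ (f i) * starRingEnd ℂ w / w).im = 0 := by
        apply mul_self_eq_zero.1; linarith
      exact Complex.ext (by simpa using h1) (by simpa using h3)
    have hw' : starRingEnd ℂ w ≠ 0 := by simpa using hw
    have hfc : ∀ i, f i = f 0 := by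
      intro i
      apply hψ
      have h := (hneg i).trans (hneg 0).symm
      rw [div_left_inj' hw] at h
      exact mul_right_cancel₀ hw' h
    have hopp : ∀ i, ψ i + ψ (f 0 - i) = 0 := by
      intro i
      have h := hneg i
      rw [div_eq_iff hw] at h
      rw [← hfc i, ← key i, h]
      ring
    -- `i = 0` gives `ψ (f 0) = -1` and `i = 1` gives `ψ (f 0) = -(ψ 1) ^ 2`. Together `ψ 2 = 1`,
    -- against injectivity.
    have h0 := hopp 0
    have h1 := hopp 1
    rw [sub_zero, AddChar.map_zero_eq_one] at h0
    have h2 : ψ (f 0) = ψ 1 * ψ (f 0 - 1) := by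
      rw [← AddChar.map_add_eq_mul]; congr 1; ring
    apply hne2
    apply hψ
    have h3 : ψ 2 = ψ 1 * ψ 1 := by rw [← AddChar.map_add_eq_mul, one_add_one_eq_two]
    rw [h3, AddChar.map_zero_eq_one]
    linear_combination ψ 1 * h1 - h0 + h2
  refine ⟨hw, ?_⟩
  have h := key 0
  rw [hw, map_zero, mul_zero, add_zero, AddChar.map_zero_eq_one] at h
  have h1 : ψ (f 0 - 0) = -1 := by linear_combination -h
  have h2 : ψ (f 0 - 0) ^ n = 1 := by
    rw [← AddChar.map_nsmul_eq_pow, nsmul_eq_mul, ZMod.natCast_self, zero_mul,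
      AddChar.map_zero_eq_one]
  rw [h1] at h2
  by_contra hodd
  rw [Nat.not_even_iff_odd] at hodd
  rw [hodd.neg_one_pow] at h2
  norm_num at h2

end RegularPolygon

namespace Arrangement

/-! ### Hyperplanes as normalized functionals -/

section Dual

variable {V : Type*} [AddCommGroup V] [Module ℝ V]

open Module

theorem isCoatom_ker_of_ne_zero {h : Dual ℝ V} (hh : h ≠ 0) : IsCoatom (LinearMap.ker h) :=
  LinearMap.isCoatom_ker_of_surjective (LinearMap.surjective hh)

theorem exists_dual_ker_eq {H : Submodule ℝ V} (hH : IsCoatom H) {x : V} (hx : x ∉ H) :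
    ∃ h : Dual ℝ V, LinearMap.ker h = H ∧ h x = 1 := by
  obtain ⟨f, hf0, hf⟩ := Submodule.exists_le_ker_of_lt_top H hH.lt_top
  have hker : LinearMap.ker f = H :=
    (hH.le_iff.1 hf).resolve_left fun h => hf0 (LinearMap.ker_eq_top.1 h)
  have hfx : f x ≠ 0 := fun h => hx (hker ▸ LinearMap.mem_ker.2 h)
  refine ⟨(f x)⁻¹ • f, ?_, by simp [hfx]⟩
  rw [LinearMap.ker_smul _ _ (inv_ne_zero hfx), hker]

theorem exists_eq_smul_of_ker_le {f g : Dual ℝ V} (h : LinearMap.ker g ≤ LinearMap.ker f) :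
    ∃ t : ℝ, f = t • g := by
  by_cases hg : g = 0
  · subst hg
    refine ⟨0, ?_⟩
    rw [LinearMap.ker_zero, top_le_iff, LinearMap.ker_eq_top] at h
    simpa using h
  · obtain ⟨y, hy⟩ := LinearMap.surjective hg 1
    refine ⟨f y, LinearMap.ext fun v => ?_⟩
    have : v - g v • y ∈ LinearMap.ker g := by simp [hy]
    have := LinearMap.mem_ker.1 (h this)
    rw [map_sub, map_smul, sub_eq_zero, smul_eq_mul] at this
    rw [this, LinearMap.smul_apply, smul_eq_mul, mul_comm]

theorem dual_eq_of_ker_eq {x : V} {h k : Dual ℝ V} (hx : h x = 1) (kx : k x = 1)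
    (hk : LinearMap.ker h = LinearMap.ker k) : h = k := by
  obtain ⟨t, ht⟩ := exists_eq_smul_of_ker_le hk.ge
  have : t = 1 := by simpa [ht, kx] using hx
  rw [ht, this, one_smul]

/-- Where `h` and `k` agree on `v`, subtracting `h v • x` moves `v` into both kernels. This turns
joins with `X` into directions of difference vectors. -/
theorem span_sup_ker_inf_ker {x : V} {h k : Dual ℝ V} (hx : h x = 1) (kx : k x = 1) :
    Submodule.span ℝ {x} ⊔ (LinearMap.ker h ⊓ LinearMap.ker k) = LinearMap.ker (h - k) := by
  apply le_antisymm
  · refine sup_le ?_ ?_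
    · rw [Submodule.span_singleton_le_iff_mem]
      simp [hx, kx]
    · rintro v ⟨h1, h2⟩
      simp [LinearMap.mem_ker.1 h1, LinearMap.mem_ker.1 h2]
  · intro v hv
    have hv' : h v = k v := sub_eq_zero.1 hv
    refine Submodule.mem_sup.2 ⟨h v • x, Submodule.smul_mem _ _ (Submodule.mem_span_singleton_self x),
      v - h v • x, ⟨?_, ?_⟩, by abel⟩
    · simp [hx]
    · simp [kx, hv']

end Dual

/-! ### Flats, modularity and lattice isomorphisms -/

section Flats

variable {V : Type*} [AddCommGroup V] [Module ℝ V] {W : Type*} [AddCommGroup W] [Module ℝ W]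
  {A : Arrangement V} {B : Arrangement W}

theorem mem_flats_of_mem_hyperplanes {H : Submodule ℝ V} (hH : H ∈ A.hyperplanes) : H ∈ A.flats :=
  ⟨{H}, Set.singleton_subset_iff.2 hH, by simp⟩

theorem top_mem_flats : (⊤ : Submodule ℝ V) ∈ A.flats := ⟨∅, Set.empty_subset _, by simp⟩

theorem inf_mem_flats {X Y : Submodule ℝ V} (hX : X ∈ A.flats) (hY : Y ∈ A.flats) :
    X ⊓ Y ∈ A.flats := by
  obtain ⟨S, hS, rfl⟩ := hX
  obtain ⟨T, hT, rfl⟩ := hY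
  exact ⟨S ∪ T, Set.union_subset hS hT, sInf_union.symm⟩

theorem exists_hyperplane_ge {X : Submodule ℝ V} (hX : X ∈ A.flats) (hne : X ≠ ⊤) :
    ∃ H ∈ A.hyperplanes, X ≤ H := by
  obtain ⟨S, hS, rfl⟩ := hX
  rcases S.eq_empty_or_nonempty with rfl | ⟨H, hH⟩
  · simp at hne
  · exact ⟨H, hS hH, sInf_le hH⟩

theorem mem_hyperplanes_of_isCoatom {X : Submodule ℝ V} (hX : X ∈ A.flats) (hc : IsCoatom X) :
    X ∈ A.hyperplanes := by
  obtain ⟨H, hH, hle⟩ := exists_hyperplane_ge hX hc.1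
  rcases hc.le_iff.1 hle with h | h
  · exact absurd h (A.isCoatom_of_mem H hH).1
  · exact h ▸ hH

theorem sInf_localization {X : Submodule ℝ V} (hX : X ∈ A.flats) :
    sInf (A.localization X).hyperplanes = X := by
  apply le_antisymm
  · obtain ⟨S, hS, rfl⟩ := hX
    exact sInf_le_sInf fun H hH => ⟨hS hH, sInf_le hH⟩
  · exact le_sInf fun H hH => hH.2

-- Modularity makes the sum of the line and `ker h ⊓ ker k` a flat. This sum is the hyperplane `ker
-- (h - k)`, and a flat of codimension one belongs to the arrangement.
open Module in
theorem IsModular.ker_sub_mem {x : V} (hmod : A.IsModular (Submodule.span ℝ {x})) {h k : Dual ℝ V}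
    (hh : LinearMap.ker h ∈ A.hyperplanes) (hk : LinearMap.ker k ∈ A.hyperplanes)
    (hx : h x = 1) (kx : k x = 1) (hne : h ≠ k) :
    LinearMap.ker (h - k) ∈ (A.localization (Submodule.span ℝ {x})).hyperplanes := by
  refine ⟨mem_hyperplanes_of_isCoatom ?_ (isCoatom_ker_of_ne_zero (sub_ne_zero.2 hne)), ?_⟩
  · rw [← span_sup_ker_inf_ker hx kx]
    exact hmod.2 _ (inf_mem_flats (mem_flats_of_mem_hyperplanes hh)
      (mem_flats_of_mem_hyperplanes hk))
  · rw [← span_sup_ker_inf_ker hx kx]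
    exact le_sup_left

/-- A pair of mutually inverse order isomorphisms of the intersection lattices, extended to all
subspaces. -/
structure FlatCorrespondence (A : Arrangement V) (B : Arrangement W) where
  toFun : Submodule ℝ V → Submodule ℝ W
  invFun : Submodule ℝ W → Submodule ℝ V
  map_mem : ∀ Y ∈ A.flats, toFun Y ∈ B.flats
  inv_mem : ∀ Y ∈ B.flats, invFun Y ∈ A.flats
  left_inv : ∀ Y ∈ A.flats, invFun (toFun Y) = Y
  right_inv : ∀ Y ∈ B.flats, toFun (invFun Y) = Y
  le_iff : ∀ Y ∈ A.flats, ∀ Z ∈ A.flats, toFun Y ≤ toFun Z ↔ Y ≤ Z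

theorem LatticeEquiv.nonempty_flatCorrespondence (h : A.LatticeEquiv B) :
    Nonempty (FlatCorrespondence A B) := by
  obtain ⟨e⟩ := h
  let f : A.flats → B.flats := fun Y => OrderDual.ofDual (e (OrderDual.toDual Y))
  let g : B.flats → A.flats := fun Y => OrderDual.ofDual (e.symm (OrderDual.toDual Y))
  have hfg : ∀ Y, f (g Y) = Y := fun Y => e.apply_symm_apply _
  have hgf : ∀ Y, g (f Y) = Y := fun Y => e.symm_apply_apply _
  have hle : ∀ Y Z, f Y ≤ f Z ↔ Y ≤ Z := fun Y Z =>
    e.le_iff_le (x := OrderDual.toDual Z) (y := OrderDual.toDual Y)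
  classical
  -- The value `⊥` off the flats is a dummy; the required properties concern flats only.
  refine ⟨⟨fun Y => if hY : Y ∈ A.flats then f ⟨Y, hY⟩ else ⊥,
    fun Y => if hY : Y ∈ B.flats then g ⟨Y, hY⟩ else ⊥, ?_, ?_, ?_, ?_, ?_⟩⟩
  · intro Y hY; rw [dif_pos hY]; exact (f _).2
  · intro Y hY; rw [dif_pos hY]; exact (g _).2
  · intro Y hY; simp [hY, hgf]
  · intro Y hY; simp [hY, hfg]
  · intro Y hY Z hZ
    simp only [dif_pos hY, dif_pos hZ]
    exact hle ⟨Y, hY⟩ ⟨Z, hZ⟩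

namespace FlatCorrespondence

/-- The inverse correspondence. -/
def symm (F : FlatCorrespondence A B) : FlatCorrespondence B A where
  toFun := F.invFun
  invFun := F.toFun
  map_mem := F.inv_mem
  inv_mem := F.map_mem
  left_inv := F.right_inv
  right_inv := F.left_inv
  le_iff Y hY Z hZ := by
    rw [← F.le_iff _ (F.inv_mem Y hY) _ (F.inv_mem Z hZ), F.right_inv Y hY, F.right_inv Z hZ]

theorem map_top (F : FlatCorrespondence A B) : F.toFun ⊤ = ⊤ := by
  rw [← top_le_iff, ← F.right_inv _ top_mem_flats,
    F.le_iff _ (F.inv_mem _ top_mem_flats) _ top_mem_flats]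
  exact le_top

theorem map_hyperplane (F : FlatCorrespondence A B) {H : Submodule ℝ V}
    (hH : H ∈ A.hyperplanes) : F.toFun H ∈ B.hyperplanes := by
  have hHf := mem_flats_of_mem_hyperplanes hH
  have hc := A.isCoatom_of_mem H hH
  have hne : F.toFun H ≠ ⊤ := by
    intro h
    apply hc.1
    rw [← F.left_inv H hHf, h]
    exact F.symm.map_top
  obtain ⟨K, hK, hle⟩ := exists_hyperplane_ge (F.map_mem H hHf) hne
  have hKf := mem_flats_of_mem_hyperplanes hK
  have hle' : H ≤ F.invFun K := by
    rwa [← F.le_iff H hHf _ (F.inv_mem K hKf), F.right_inv K hKf]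
  rcases hc.le_iff.1 hle' with h | h
  · refine absurd ?_ (B.isCoatom_of_mem K hK).1
    rw [← F.right_inv K hKf, h, F.map_top]
  · rwa [← h, F.right_inv K hKf]

theorem injOn (F : FlatCorrespondence A B) : Set.InjOn F.toFun A.flats := by
  intro Y hY Z hZ h
  rw [← F.left_inv Y hY, h, F.left_inv Z hZ]

/-- The hyperplanes above a flat correspond to the hyperplanes above its image. -/
theorem image_localization (F : FlatCorrespondence A B) {Y : Submodule ℝ V} (hY : Y ∈ A.flats) :
    F.toFun '' (A.localization Y).hyperplanes = (B.localization (F.toFun Y)).hyperplanes := by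
  apply Set.Subset.antisymm
  · rintro _ ⟨H, ⟨hH, hle⟩, rfl⟩
    exact ⟨F.map_hyperplane hH, (F.le_iff Y hY H (mem_flats_of_mem_hyperplanes hH)).2 hle⟩
  · rintro K ⟨hK, hle⟩
    have hKf := mem_flats_of_mem_hyperplanes hK
    refine ⟨F.invFun K, ⟨F.symm.map_hyperplane hK, ?_⟩, F.right_inv K hKf⟩
    rwa [← F.le_iff Y hY _ (F.inv_mem K hKf), F.right_inv K hKf]

theorem ncard_localization (F : FlatCorrespondence A B) {Y : Submodule ℝ V} (hY : Y ∈ A.flats) :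
    (B.localization (F.toFun Y)).hyperplanes.ncard = (A.localization Y).hyperplanes.ncard := by
  rw [← F.image_localization hY]
  exact (F.injOn.mono fun H hH => mem_flats_of_mem_hyperplanes hH.1).ncard_image

theorem ncard_hyperplanes (F : FlatCorrespondence A B) :
    B.hyperplanes.ncard = A.hyperplanes.ncard := by
  have h : F.toFun '' A.hyperplanes = B.hyperplanes := by
    apply Set.Subset.antisymm
    · rintro _ ⟨H, hH, rfl⟩
      exact F.map_hyperplane hH
    · intro K hK
      exact ⟨F.invFun K, F.symm.map_hyperplane hK, F.right_inv K (mem_flats_of_mem_hyperplanes hK)⟩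
  rw [← h]
  exact (F.injOn.mono fun H hH => mem_flats_of_mem_hyperplanes hH).ncard_image

end FlatCorrespondence

theorem latticeEquiv_of_linearEquiv (φ : V ≃ₗ[ℝ] W)
    (h : A.hyperplanes = Submodule.comap (φ : V →ₗ[ℝ] W) '' B.hyperplanes) : A.LatticeEquiv B := by
  let o : Submodule ℝ V ≃o Submodule ℝ W := Submodule.orderIsoMapComap φ
  have hs : ∀ Y, o.symm Y = Submodule.comap (φ : V →ₗ[ℝ] W) Y := fun Y => rfl
  have hAB : o.symm '' B.hyperplanes = A.hyperplanes := by rw [h]; rfl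
  have hBA : o '' A.hyperplanes = B.hyperplanes := by
    rw [← hAB, Set.image_image]
    simp
  have hmem : ∀ Y, o Y ∈ B.flats ↔ Y ∈ A.flats := by
    intro Y
    constructor
    · rintro ⟨S, hS, hY⟩
      refine ⟨o.symm '' S, ?_, ?_⟩
      · rw [← hAB]; exact Set.image_mono hS
      · rw [sInf_image, ← o.symm.map_sInf, ← hY, o.symm_apply_apply]
    · rintro ⟨S, hS, rfl⟩
      refine ⟨o '' S, ?_, ?_⟩
      · rw [← hBA]; exact Set.image_mono hS
      · rw [sInf_image, ← o.map_sInf]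
  let e : A.flats ≃o B.flats :=
    { toEquiv := o.toEquiv.subtypeEquiv fun Y => (hmem Y).symm
      map_rel_iff' := o.le_iff_le }
  exact ⟨e.dual⟩

end Flats

/-! ### Reducibility, for the case `n = 2` -/

section Reducible

variable {V : Type*} [AddCommGroup V] [Module ℝ V] {A : Arrangement V}

open Module

/-- By the modular law each `H ≠ M` is `(H ⊓ M) ⊔ P`. The factors are the traces of these `H` on
`M`, and the zero subspace of `P`. -/
theorem isReducible_of_isCompl {M P : Submodule ℝ V} (hMP : IsCompl M P) (hM0 : M ≠ ⊥)
    (hP0 : P ≠ ⊥) (hM : M ∈ A.hyperplanes) (hP : ∀ H ∈ A.hyperplanes, H ≠ M → P ≤ H) :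
    A.IsReducible := by
  have hcomap : ∀ (Q H : Submodule ℝ V), IsCoatom H → ¬ Q ≤ H → IsCoatom (H.comap Q.subtype) := by
    intro Q H hH hQ
    obtain ⟨x, hx, hxH⟩ := SetLike.not_le_iff_exists.1 hQ
    obtain ⟨h, rfl, hx1⟩ := exists_dual_ker_eq hH hxH
    rw [← LinearMap.ker_comp]
    apply isCoatom_ker_of_ne_zero
    intro h0
    have := LinearMap.congr_fun h0 ⟨x, hx⟩
    simp [hx1] at this
  have hPM : ¬ P ≤ M := fun h => hP0 (by rw [← inf_eq_right.2 h, hMP.inf_eq_bot])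
  have hHM : ∀ H ∈ A.hyperplanes, H ≠ M → ¬ M ≤ H := by
    intro H hH hne hle
    rcases (A.isCoatom_of_mem M hM).le_iff.1 hle with h | h
    · exact (A.isCoatom_of_mem H hH).1 h
    · exact hne h
  refine ⟨M, P, hMP, hM0, hP0,
    ⟨(fun H => H.comap M.subtype) '' (A.hyperplanes \ {M}),
      (A.finite_hyperplanes.subset Set.sdiff_subset).image _, ?_⟩,
    ⟨{M.comap P.subtype}, Set.finite_singleton _, ?_⟩, ?_⟩
  · rintro _ ⟨H, ⟨hH, hne⟩, rfl⟩
    exact hcomap M H (A.isCoatom_of_mem H hH) (hHM H hH hne)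
  · rintro _ rfl
    exact hcomap P M (A.isCoatom_of_mem M hM) hPM
  · have h1 : ∀ H ∈ A.hyperplanes, H ≠ M → (H.comap M.subtype).map M.subtype ⊔ P = H := by
      intro H hH hne
      rw [Submodule.map_comap_subtype, inf_comm, inf_sup_assoc_of_le M (hP H hH hne),
        hMP.sup_eq_top, inf_top_eq]
    have h2 : M ⊔ (M.comap P.subtype).map P.subtype = M := by
      rw [Submodule.map_comap_subtype, inf_comm, hMP.inf_eq_bot, sup_bot_eq]
    simp only [Set.image_singleton, h2, Set.image_image]
    ext H
    constructor
    · intro hH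
      by_cases hne : H = M
      · right; exact hne
      · left; exact ⟨H, ⟨hH, hne⟩, h1 H hH hne⟩
    · rintro (⟨K, ⟨hK, hne⟩, rfl⟩ | rfl)
      · change (K.comap M.subtype).map M.subtype ⊔ P ∈ _
        rw [h1 K hK hne]
        exact hK
      · exact hM

/-- If only two hyperplanes contain a modular line, and at least two do not, then all but one
hyperplane share a line. -/
theorem IsModular.isReducible_of_pair {x : V} (hx : x ≠ 0)
    (hmod : A.IsModular (Submodule.span ℝ {x})) {M N : Submodule ℝ V} (hMN : M ≠ N)
    (hloc : (A.localization (Submodule.span ℝ {x})).hyperplanes = {M, N}) {h k : Dual ℝ V}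
    (hh : LinearMap.ker h ∈ A.hyperplanes) (hk : LinearMap.ker k ∈ A.hyperplanes)
    (hx1 : h x = 1) (kx1 : k x = 1) (hne : h ≠ k) : A.IsReducible := by
  wlog hN : LinearMap.ker (h - k) = N generalizing M N
  · refine this hMN.symm (by rw [hloc, Set.pair_comm]) ?_
    have := hmod.ker_sub_mem hh hk hx1 kx1 hne
    rw [hloc] at this
    exact this.resolve_right hN
  have hMloc : M ∈ (A.localization (Submodule.span ℝ {x})).hyperplanes := by simp [hloc]
  have hNloc : N ∈ (A.localization (Submodule.span ℝ {x})).hyperplanes := by simp [hloc]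
  have hMc := A.isCoatom_of_mem M hMloc.1
  have hNc := A.isCoatom_of_mem N hNloc.1
  have hinf : M ⊓ N = Submodule.span ℝ {x} := by
    rw [← sInf_localization hmod.1, hloc, sInf_pair]
  set P := LinearMap.ker h ⊓ LinearMap.ker k with hP
  have hPN : P ≤ N := by
    rw [← hN, ← span_sup_ker_inf_ker hx1 kx1]
    exact le_sup_right
  have hNM : ¬ N ≤ M := fun hle => (hNc.le_iff.1 hle).elim hMc.1 hMN
  have hPM : ¬ P ≤ M := by
    intro hle
    apply hNM
    rw [← hN, ← span_sup_ker_inf_ker hx1 kx1]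
    exact sup_le hMloc.2 hle
  have hcompl : IsCompl M P := by
    constructor
    · rw [disjoint_iff, eq_bot_iff]
      rintro v ⟨hvM, hvP⟩
      have hv : v ∈ M ⊓ N := ⟨hvM, hPN hvP⟩
      rw [hinf] at hv
      obtain ⟨t, rfl⟩ := Submodule.mem_span_singleton.1 hv
      have := LinearMap.mem_ker.1 hvP.1
      rw [map_smul, hx1, smul_eq_mul, mul_one] at this
      simp [this]
    · rw [codisjoint_iff]
      exact hMc.2 _ (left_lt_sup.2 hPM)
  refine isReducible_of_isCompl hcompl ?_ ?_ hMloc.1 ?_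
  · intro h0
    apply hx
    have := hMloc.2 (Submodule.mem_span_singleton_self x)
    rwa [h0, Submodule.mem_bot] at this
  · intro h0
    exact hPM (h0 ▸ bot_le)
  · intro H hH hHM
    by_cases hxH : x ∈ H
    · have : H ∈ (A.localization (Submodule.span ℝ {x})).hyperplanes :=
        ⟨hH, (Submodule.span_singleton_le_iff_mem _ _).2 hxH⟩
      rw [hloc] at this
      rw [this.resolve_left hHM]
      exact hPN
    · obtain ⟨l, rfl, hl⟩ := exists_dual_ker_eq (A.isCoatom_of_mem H hH) hxH
      -- In the affine plane, `l` lies on the line through `h` and `k` as soon as one of `l - h`, `l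
      -- - k` has direction `N`. Both having direction `M` would give `h - k` direction `M` too.
      have hon : ∀ m : Dual ℝ V, P ≤ LinearMap.ker m → N ≤ LinearMap.ker (l - m) →
          P ≤ LinearMap.ker l := by
        intro m h1 h2 v hv
        have e1 := LinearMap.mem_ker.1 (h1 hv)
        have e2 := LinearMap.mem_ker.1 (h2 (hPN hv))
        rw [LinearMap.sub_apply, e1, sub_zero] at e2
        exact e2
      by_cases e1 : l = h
      · rw [e1]; exact inf_le_left
      by_cases e2 : l = k
      · rw [e2]; exact inf_le_right
      have h1 := hmod.ker_sub_mem hH hh hl hx1 e1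
      have h2 := hmod.ker_sub_mem hH hk hl kx1 e2
      rw [hloc] at h1 h2
      rcases h1 with h1 | h1
      · rcases h2 with h2 | h2
        · exfalso
          have hle : M ≤ N := by
            intro v hv
            have e3 : v ∈ LinearMap.ker (l - h) := h1 ▸ hv
            have e4 : v ∈ LinearMap.ker (l - k) := h2 ▸ hv
            rw [LinearMap.mem_ker, LinearMap.sub_apply] at e3 e4
            rw [← hN, LinearMap.mem_ker, LinearMap.sub_apply]
            linarith
          exact (hMc.le_iff.1 hle).elim hNc.1 hMN.symm
        · exact hon k inf_le_right h2.ge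
      · exact hon h inf_le_left h1.ge

end Reducible

end Arrangement

namespace Arrangement

/-! ### Incidences in `A(2n,1)` -/

section Series

/-- The `k`-th hyperplane through the axis of `A(2n,1)`. -/
noncomputable def mirror (n k : ℕ) : Submodule ℝ (Fin 3 → ℝ) := perp ![-sinN n k, cosN n k, 0]

/-- The `j`-th hyperplane of `A(2n,1)` not through the axis. -/
noncomputable def side (n j : ℕ) : Submodule ℝ (Fin 3 → ℝ) :=
  perp ![cosN n (2 * j + 1), sinN n (2 * j + 1), 1]

theorem cosN_eq (n m : ℕ) : cosN n m = Real.cos (m * (Real.pi / n)) := by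
  rw [cosN]
  congr 1
  rw [mul_assoc, mul_div_mul_left _ _ two_ne_zero]
  ring

theorem sinN_eq (n m : ℕ) : sinN n m = Real.sin (m * (Real.pi / n)) := by
  rw [sinN]
  congr 1
  rw [mul_assoc, mul_div_mul_left _ _ two_ne_zero]
  ring

theorem mem_mirror {n k : ℕ} {v : Fin 3 → ℝ} :
    v ∈ mirror n k ↔ cosN n k * v 1 = sinN n k * v 0 := by
  rw [mirror, mem_perp]
  simp
  constructor <;> intro h <;> linarith

theorem mem_side {n j : ℕ} {v : Fin 3 → ℝ} :
    v ∈ side n j ↔ cosN n (2 * j + 1) * v 0 + sinN n (2 * j + 1) * v 1 + v 2 = 0 := by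
  rw [side, mem_perp]
  simp

theorem mirror_add_mul {n : ℕ} (hn : n ≠ 0) (k q : ℕ) : mirror n (k + n * q) = mirror n k := by
  have hn' : (n : ℝ) ≠ 0 := by exact_mod_cast hn
  have e : ((k + n * q : ℕ) : ℝ) * (Real.pi / n) = k * (Real.pi / n) + q * Real.pi := by
    push_cast
    field_simp
  ext v
  rw [mem_mirror, mem_mirror, cosN_eq, sinN_eq, cosN_eq, sinN_eq, e, Real.cos_add_nat_mul_pi,
    Real.sin_add_nat_mul_pi, mul_assoc, mul_assoc]
  have : ((-1 : ℝ)) ^ q ≠ 0 := pow_ne_zero _ (by norm_num)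
  exact mul_right_inj' this

theorem mirror_mod {n : ℕ} (hn : n ≠ 0) (k : ℕ) : mirror n (k % n) = mirror n k := by
  conv_rhs => rw [← Nat.mod_add_div k n]
  rw [mirror_add_mul hn]

theorem mirror_congr {n : ℕ} [NeZero n] {k k' : ℕ} (h : (k : ZMod n) = k') :
    mirror n k = mirror n k' := by
  rw [ZMod.natCast_eq_natCast_iff'] at h
  rw [← mirror_mod (NeZero.ne n), h, mirror_mod (NeZero.ne n)]

theorem sin_ne_zero_of_lt {n : ℕ} {i j : ℕ} (hi : i < n) (hj : j < n) (hij : i ≠ j) :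
    Real.sin (((i : ℝ) - j) * (Real.pi / n)) ≠ 0 := by
  have hn : (0 : ℝ) < n := by exact_mod_cast (by omega : 0 < n)
  wlog h : j < i generalizing i j
  · have := this hj hi hij.symm (by omega)
    rwa [← neg_ne_zero, ← Real.sin_neg, ← neg_mul, neg_sub] at this
  have h1 : (0 : ℝ) < (i : ℝ) - j := by
    have : (j : ℝ) < i := by exact_mod_cast h
    linarith
  have h2 : (i : ℝ) - j < n := by
    have : (i : ℝ) < n := by exact_mod_cast hi
    have : (0 : ℝ) ≤ j := by positivity
    linarith
  apply ne_of_gt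
  apply Real.sin_pos_of_pos_of_lt_pi
  · have := Real.pi_pos
    positivity
  · rw [← mul_div_assoc, div_lt_iff₀ hn, mul_comm]
    exact mul_lt_mul_of_pos_left h2 Real.pi_pos

theorem eq_of_mem_mirror {n k k' : ℕ} (hk : k < n) (hk' : k' < n) {v : Fin 3 → ℝ}
    (hv : v 0 ≠ 0 ∨ v 1 ≠ 0) (h : v ∈ mirror n k) (h' : v ∈ mirror n k') : k = k' := by
  by_contra hne
  have hs := sin_ne_zero_of_lt hk hk' hne
  rw [mem_mirror, cosN_eq, sinN_eq] at h h'
  rw [sub_mul, Real.sin_sub] at hs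
  rcases hv with hv | hv
  · apply hv
    have : (Real.sin (k * (Real.pi / n)) * Real.cos (k' * (Real.pi / n))
      - Real.cos (k * (Real.pi / n)) * Real.sin (k' * (Real.pi / n))) * v 0 = 0 := by
      linear_combination Real.cos (k * (Real.pi / n)) * h' - Real.cos (k' * (Real.pi / n)) * h
    exact (mul_eq_zero.1 this).resolve_left hs
  · apply hv
    have : (Real.sin (k * (Real.pi / n)) * Real.cos (k' * (Real.pi / n))
      - Real.cos (k * (Real.pi / n)) * Real.sin (k' * (Real.pi / n))) * v 1 = 0 := by
      linear_combination Real.sin (k * (Real.pi / n)) * h' - Real.sin (k' * (Real.pi / n)) * h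
    exact (mul_eq_zero.1 this).resolve_left hs

/-- Writing the two angles as half-sum `s` plus or minus half-difference `d`, the difference of the
two equations is `2 sin d` times the mirror equation at angle `s`, and `sin d ≠ 0`. -/
theorem side_inf_side_le {n i j : ℕ} (hi : i < n) (hj : j < n) (hij : i ≠ j) :
    side n i ⊓ side n j ≤ mirror n (i + j + 1) := by
  rintro v ⟨h1, h2⟩
  rw [mem_mirror]
  replace h1 := mem_side.1 h1
  replace h2 := mem_side.1 h2
  have hs := sin_ne_zero_of_lt hi hj hij
  simp only [cosN_eq, sinN_eq] at h1 h2 ⊢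
  set s := ((i : ℝ) + j + 1) * (Real.pi / n) with hsdef
  set d := ((i : ℝ) - j) * (Real.pi / n) with hd
  have e1 : ((2 * i + 1 : ℕ) : ℝ) * (Real.pi / n) = s + d := by
    rw [hsdef, hd]; push_cast; ring
  have e2 : ((2 * j + 1 : ℕ) : ℝ) * (Real.pi / n) = s - d := by
    rw [hsdef, hd]; push_cast; ring
  have e3 : ((i + j + 1 : ℕ) : ℝ) * (Real.pi / n) = s := by
    rw [hsdef]; push_cast; ring
  rw [e1, Real.cos_add, Real.sin_add] at h1
  rw [e2, Real.cos_sub, Real.sin_sub] at h2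
  rw [e3]
  have : Real.sin d * (Real.cos s * v 1 - Real.sin s * v 0) = 0 := by
    linear_combination (h1 - h2) / 2
  exact sub_eq_zero.1 ((mul_eq_zero.1 this).resolve_left hs)

/-- Three hyperplanes off the axis meet only on the axis. -/
theorem not_mem_three_sides {n i j k : ℕ} (hi : i < n) (hj : j < n) (hk : k < n) (hij : i ≠ j)
    (hik : i ≠ k) (hjk : j ≠ k) {v : Fin 3 → ℝ} (hv : v 0 ≠ 0 ∨ v 1 ≠ 0) (h1 : v ∈ side n i)
    (h2 : v ∈ side n j) (h3 : v ∈ side n k) : False := by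
  have hn : n ≠ 0 := by omega
  have a := side_inf_side_le hi hj hij ⟨h1, h2⟩
  have b := side_inf_side_le hi hk hik ⟨h1, h3⟩
  rw [← mirror_mod hn] at a b
  have h := eq_of_mem_mirror (Nat.mod_lt _ (by omega)) (Nat.mod_lt _ (by omega)) hv a b
  have h' : i + j + 1 ≡ i + k + 1 [MOD n] := h
  have h'' : j ≡ k [MOD n] := Nat.ModEq.add_left_cancel' i (Nat.ModEq.add_right_cancel' 1 h')
  exact hjk (Nat.ModEq.eq_of_lt_of_lt h'' hj hk)

theorem mem_A2n {n : ℕ} {H : Submodule ℝ (Fin 3 → ℝ)} :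
    H ∈ (A2n n).hyperplanes ↔ (∃ k < n, mirror n k = H) ∨ ∃ j < n, side n j = H := by
  constructor
  · rintro (⟨k, rfl⟩ | ⟨j, rfl⟩)
    · exact Or.inl ⟨k, k.2, rfl⟩
    · exact Or.inr ⟨j, j.2, rfl⟩
  · rintro (⟨k, hk, rfl⟩ | ⟨j, hj, rfl⟩)
    · exact Or.inl ⟨⟨k, hk⟩, rfl⟩
    · exact Or.inr ⟨⟨j, hj⟩, rfl⟩

theorem mirror_mem_A2n {n : ℕ} (hn : n ≠ 0) (k : ℕ) : mirror n k ∈ (A2n n).hyperplanes :=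
  mem_A2n.2 (Or.inl ⟨k % n, Nat.mod_lt _ (Nat.pos_of_ne_zero hn), mirror_mod hn k⟩)

theorem side_mem_A2n {n j : ℕ} (hj : j < n) : side n j ∈ (A2n n).hyperplanes :=
  mem_A2n.2 (Or.inr ⟨j, hj, rfl⟩)

theorem axis_not_mem_side (n j : ℕ) : ![0, 0, 1] ∉ side n j := by
  rw [mem_side]
  simp

theorem axis_mem_mirror (n k : ℕ) : ![0, 0, 1] ∈ mirror n k := by
  rw [mem_mirror]
  simp

theorem mirror_ne_side (n k j : ℕ) : mirror n k ≠ side n j := fun h =>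
  axis_not_mem_side n j (h ▸ axis_mem_mirror n k)

theorem isCoatom_mirror {n k : ℕ} (hk : k < n) : IsCoatom (mirror n k) :=
  (A2n n).isCoatom_of_mem _ (mem_A2n.2 (Or.inl ⟨k, hk, rfl⟩))

theorem isCoatom_side {n j : ℕ} (hj : j < n) : IsCoatom (side n j) :=
  (A2n n).isCoatom_of_mem _ (mem_A2n.2 (Or.inr ⟨j, hj, rfl⟩))

theorem mirror_inj {n k k' : ℕ} (hk : k < n) (hk' : k' < n) (h : mirror n k = mirror n k') :
    k = k' := by
  have hv : ![cosN n k, sinN n k, 0] ∈ mirror n k := by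
    rw [mem_mirror]
    simp [mul_comm]
  refine eq_of_mem_mirror hk hk' (v := ![cosN n k, sinN n k, 0]) ?_ hv (h ▸ hv)
  by_contra! h0
  have h1 : cosN n k = 0 := by simpa using h0.1
  have h2 : sinN n k = 0 := by simpa using h0.2
  rw [cosN_eq] at h1
  rw [sinN_eq] at h2
  have := Real.sin_sq_add_cos_sq (k * (Real.pi / n))
  rw [h1, h2] at this
  norm_num at this

theorem side_inj {n j j' : ℕ} (hj : j < n) (hj' : j' < n) (h : side n j = side n j') : j = j' := by
  by_contra hne
  have hle := side_inf_side_le hj hj' hne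
  rw [← h, inf_idem, ← mirror_mod (by omega)] at hle
  rcases (isCoatom_side hj).le_iff.1 hle with h' | h'
  · exact (isCoatom_mirror (Nat.mod_lt _ (by omega))).1 h'
  · exact mirror_ne_side _ _ _ h'

theorem ncard_A2n (n : ℕ) : (A2n n).hyperplanes.ncard = 2 * n := by
  have h : (A2n n).hyperplanes = Set.range (fun k : Fin n => mirror n k) ∪
    Set.range (fun j : Fin n => side n j) := rfl
  rw [h, Set.ncard_union_eq ?_ (Set.finite_range _) (Set.finite_range _),
    Set.ncard_range_of_injective, Set.ncard_range_of_injective, Nat.card_fin, two_mul]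
  · intro i j hij
    exact Fin.ext (side_inj i.2 j.2 hij)
  · intro i j hij
    exact Fin.ext (mirror_inj i.2 j.2 hij)
  · rw [Set.disjoint_left]
    rintro _ ⟨k, rfl⟩ ⟨j, hj⟩
    exact mirror_ne_side _ _ _ hj.symm

/-- At most three hyperplanes of `A(2n,1)` contain a given vector off the axis. -/
theorem ncard_localization_A2n_le {n : ℕ} {Y : Submodule ℝ (Fin 3 → ℝ)} {v : Fin 3 → ℝ}
    (hvY : v ∈ Y) (hv : v 0 ≠ 0 ∨ v 1 ≠ 0) : ((A2n n).localization Y).hyperplanes.ncard ≤ 3 := by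
  set S := {H | ∃ k < n, mirror n k = H ∧ v ∈ H} with hS
  set T := {H | ∃ j < n, side n j = H ∧ v ∈ H} with hT
  have hSfin : S.Finite := (A2n n).finite_hyperplanes.subset (by
    rintro H ⟨k, hk, h, -⟩; exact mem_A2n.2 (Or.inl ⟨k, hk, h⟩))
  have hTfin : T.Finite := (A2n n).finite_hyperplanes.subset (by
    rintro H ⟨k, hk, h, -⟩; exact mem_A2n.2 (Or.inr ⟨k, hk, h⟩))
  have hsub : ((A2n n).localization Y).hyperplanes ⊆ S ∪ T := by
    rintro H ⟨hH, hle⟩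
    rcases mem_A2n.1 hH with ⟨k, hk, h⟩ | ⟨k, hk, h⟩
    · exact Or.inl ⟨k, hk, h, hle hvY⟩
    · exact Or.inr ⟨k, hk, h, hle hvY⟩
  have h1 : S.ncard ≤ 1 := by
    rw [Set.ncard_le_one_iff hSfin]
    rintro _ _ ⟨k, hk, rfl, h⟩ ⟨k', hk', rfl, h'⟩
    rw [eq_of_mem_mirror hk hk' hv h h']
  have h2 : T.ncard ≤ 2 := by
    by_contra! h
    obtain ⟨_, _, _, ⟨a, ha, rfl, ha'⟩, ⟨b, hb, rfl, hb'⟩, ⟨c, hc, rfl, hc'⟩, hab, hac, hbc⟩ :=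
      (Set.two_lt_ncard_iff hTfin).1 h
    exact not_mem_three_sides ha hb hc (fun e => hab (e ▸ rfl)) (fun e => hac (e ▸ rfl))
      (fun e => hbc (e ▸ rfl)) hv ha' hb' hc'
  have h3 := Set.ncard_le_ncard hsub (hSfin.union hTfin)
  have h4 := Set.ncard_union_le S T
  omega

/-- A subspace contained in more than three hyperplanes of `A(2n,1)` lies on the axis. -/
theorem eq_zero_of_three_lt_ncard {n : ℕ} {Y : Submodule ℝ (Fin 3 → ℝ)}
    (hY : 3 < ((A2n n).localization Y).hyperplanes.ncard) {v : Fin 3 → ℝ} (hv : v ∈ Y) :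
    v 0 = 0 ∧ v 1 = 0 := by
  by_contra h
  exact (ncard_localization_A2n_le hv (by tauto)).not_gt hY

theorem le_mirror_of_three_lt_ncard {n : ℕ} {Y : Submodule ℝ (Fin 3 → ℝ)}
    (hY : 3 < ((A2n n).localization Y).hyperplanes.ncard) (k : ℕ) : Y ≤ mirror n k := by
  intro v hv
  have h := eq_zero_of_three_lt_ncard hY hv
  rw [mem_mirror, h.1, h.2, mul_zero, mul_zero]

end Series

end Arrangement

namespace Arrangement

open Module Function

/-! ### Labelling the hyperplanes by `ℤ/n` -/

section Labelling

variable {V : Type*} [AddCommGroup V] [Module ℝ V] {A B : Arrangement V} {x : V} {n : ℕ}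

/-- A labelling by `ℤ/n` of the hyperplanes through the line spanned by `x` (as `m`) and of `n`
further hyperplanes (as kernels of the functionals `p`), such that the `i`-th and the `j`-th of the
latter meet on the `(i + j)`-th of the former. -/
structure Labelling (B : Arrangement V) (x : V) (n : ℕ) where
  p : ZMod n → Dual ℝ V
  m : ZMod n → Submodule ℝ V
  p_injective : Injective p
  m_injective : Injective m
  p_apply : ∀ i, p i x = 1
  ker_mem : ∀ i, LinearMap.ker (p i) ∈ B.hyperplanes
  range_m : Set.range m = (B.localization (Submodule.span ℝ {x})).hyperplanes
  ker_sub : ∀ i j, i ≠ j → LinearMap.ker (p i - p j) = m (i + j)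

/-- More than three hyperplanes pass through `X`, so its image lies on the axis of `A(2n,1)`. Hence
mirrors correspond to hyperplanes through `X`, and the incidences of sides and mirrors can be pulled
back. -/
theorem nonempty_labelling_of_three_lt [NeZero n] (hn : 3 < n)
    (hX : Submodule.span ℝ {x} ∈ B.flats)
    (hcard : (B.localization (Submodule.span ℝ {x})).hyperplanes.ncard = n)
    (hB : B.LatticeEquiv (A2n n)) : Nonempty (Labelling B x n) := by
  obtain ⟨F⟩ := hB.nonempty_flatCorrespondence
  have hn0 : n ≠ 0 := NeZero.ne n
  have hFX : ∀ k, F.toFun (Submodule.span ℝ {x}) ≤ mirror n k := by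
    apply le_mirror_of_three_lt_ncard
    rw [F.ncard_localization hX, hcard]
    exact hn
  have hmir := fun k => mem_flats_of_mem_hyperplanes (mirror_mem_A2n hn0 k)
  have hside := fun i : ZMod n => mem_flats_of_mem_hyperplanes (side_mem_A2n (ZMod.val_lt i))
  -- The shift by one absorbs the `+ 1` in `side_inf_side_le`.
  set m : ZMod n → Submodule ℝ V := fun s => F.invFun (mirror n (s.val + 1)) with hm
  set l : ZMod n → Submodule ℝ V := fun i => F.invFun (side n i.val) with hl
  have hminj : Injective m := by
    intro s t hst
    have h := F.symm.injOn (hmir _) (hmir _) hst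
    rw [← mirror_mod hn0, ← mirror_mod hn0 (t.val + 1)] at h
    have h' := mirror_inj (Nat.mod_lt _ (Nat.pos_of_ne_zero hn0))
      (Nat.mod_lt _ (Nat.pos_of_ne_zero hn0)) h
    have h'' := (ZMod.natCast_eq_natCast_iff' _ _ n).2 h'
    simpa using h''
  have hrange : Set.range m = (B.localization (Submodule.span ℝ {x})).hyperplanes := by
    apply Set.eq_of_subset_of_ncard_le
    · rintro _ ⟨s, rfl⟩
      refine ⟨F.symm.map_hyperplane (mirror_mem_A2n hn0 _), ?_⟩
      rw [← F.le_iff _ hX _ (F.inv_mem _ (hmir _)), F.right_inv _ (hmir _)]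
      exact hFX _
    · rw [hcard, Set.ncard_range_of_injective hminj, Nat.card_zmod]
    · exact (B.localization _).finite_hyperplanes
  have hlB : ∀ i, l i ∈ B.hyperplanes := fun i =>
    F.symm.map_hyperplane (side_mem_A2n (ZMod.val_lt i))
  have hxl : ∀ i, x ∉ l i := by
    intro i hxi
    have h : l i ∈ (B.localization (Submodule.span ℝ {x})).hyperplanes :=
      ⟨hlB i, (Submodule.span_singleton_le_iff_mem _ _).2 hxi⟩
    rw [← hrange] at h
    obtain ⟨s, hs⟩ := h
    exact mirror_ne_side _ _ _ (F.symm.injOn (hmir _) (hside i) hs)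
  choose p hpker hpx using fun i => exists_dual_ker_eq (B.isCoatom_of_mem _ (hlB i)) (hxl i)
  have hpinj : Injective p := by
    intro i j hij
    have h : l i = l j := by rw [← hpker, ← hpker, hij]
    exact ZMod.val_injective n (side_inj (ZMod.val_lt i) (ZMod.val_lt j)
      (F.symm.injOn (hside i) (hside j) h))
  refine ⟨⟨p, m, hpinj, hminj, hpx, fun i => (hpker i).symm ▸ hlB i, hrange, ?_⟩⟩
  intro i j hij
  have hms : m (i + j) ∈ (B.localization (Submodule.span ℝ {x})).hyperplanes :=
    hrange ▸ Set.mem_range_self _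
  have hle : LinearMap.ker (p i - p j) ≤ m (i + j) := by
    rw [← span_sup_ker_inf_ker (hpx i) (hpx j), hpker, hpker]
    refine sup_le hms.2 ?_
    have hli := mem_flats_of_mem_hyperplanes (hlB i)
    have hlj := mem_flats_of_mem_hyperplanes (hlB j)
    have hlij := inf_mem_flats hli hlj
    rw [← F.le_iff _ hlij _ (F.inv_mem _ (hmir _)), F.right_inv _ (hmir _)]
    have h1 : F.toFun (l i ⊓ l j) ≤ side n i.val := by
      rw [← F.right_inv _ (hside i), F.le_iff _ hlij _ hli]
      exact inf_le_left
    have h2 : F.toFun (l i ⊓ l j) ≤ side n j.val := by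
      rw [← F.right_inv _ (hside j), F.le_iff _ hlij _ hlj]
      exact inf_le_right
    refine (le_inf h1 h2).trans ((side_inf_side_le (ZMod.val_lt i) (ZMod.val_lt j)
      fun h => hij (ZMod.val_injective n h)).trans (le_of_eq (mirror_congr ?_)))
    simp
  have hc : IsCoatom (LinearMap.ker (p i - p j)) :=
    isCoatom_ker_of_ne_zero (sub_ne_zero.2 fun h => hij (hpinj h))
  exact ((hc.le_iff.1 hle).resolve_left (B.isCoatom_of_mem _ hms.1).1).symm

/-- For three points any bijection with `ℤ/3` works, since a pair of distinct indices is determined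
by its sum. Only the noncollinearity of the points (`hnc`) has to be taken from `A(6,1)`. -/
theorem nonempty_labelling_of_eq_three (hX : Submodule.span ℝ {x} ∈ B.flats)
    (hmod : ∀ h k : Dual ℝ V, LinearMap.ker h ∈ B.hyperplanes → LinearMap.ker k ∈ B.hyperplanes →
      h x = 1 → k x = 1 → h ≠ k →
      LinearMap.ker (h - k) ∈ (B.localization (Submodule.span ℝ {x})).hyperplanes)
    (hcard : (B.localization (Submodule.span ℝ {x})).hyperplanes.ncard = 3)
    (hB : B.LatticeEquiv (A2n 3)) : Nonempty (Labelling B x 3) := by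
  obtain ⟨F⟩ := hB.nonempty_flatCorrespondence
  set D := B.hyperplanes \ (B.localization (Submodule.span ℝ {x})).hyperplanes with hD
  have hDcard : D.ncard = 3 := by
    have hsub : (B.localization (Submodule.span ℝ {x})).hyperplanes ⊆ B.hyperplanes :=
      fun H hH => hH.1
    have h1 := Set.ncard_sdiff_add_ncard_of_subset hsub B.finite_hyperplanes
    have h2 : B.hyperplanes.ncard = 2 * 3 := by rw [← F.ncard_hyperplanes, ncard_A2n]
    rw [← hD] at h1
    omega
  have hDfin : Finite D := Set.finite_of_ncard_ne_zero (by omega)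
  let l : ZMod 3 ≃ D := (Finite.equivFinOfCardEq hDcard).symm
  have hxl : ∀ i, x ∉ (l i : Submodule ℝ V) := fun i hxi =>
    (l i).2.2 ⟨(l i).2.1, (Submodule.span_singleton_le_iff_mem _ _).2 hxi⟩
  choose p hpker hpx using fun i =>
    exists_dual_ker_eq (B.isCoatom_of_mem _ (l i).2.1) (hxl i)
  have hpB : ∀ i, LinearMap.ker (p i) ∈ B.hyperplanes := fun i => by
    rw [hpker]; exact (l i).2.1
  have hkerinj : ∀ i j, LinearMap.ker (p i) = LinearMap.ker (p j) → i = j := by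
    intro i j hij
    rw [hpker, hpker] at hij
    exact l.injective (Subtype.ext hij)
  have hpinj : Injective p := fun i j hij => hkerinj i j (by rw [hij])
  have hloc : ∀ i j, i ≠ j → LinearMap.ker (p i - p j) ∈
      (B.localization (Submodule.span ℝ {x})).hyperplanes := fun i j hij =>
    hmod _ _ (hpB i) (hpB j) (hpx i) (hpx j) fun h => hij (hpinj h)
  have hnc : ∀ i j k, i ≠ j → i ≠ k → j ≠ k →
      LinearMap.ker (p i - p j) ≠ LinearMap.ker (p i - p k) := by
    intro i j k hij hik hjk heq
    set Y := LinearMap.ker (p i) ⊓ LinearMap.ker (p j) with hY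
    have hYf : Y ∈ B.flats := inf_mem_flats (mem_flats_of_mem_hyperplanes (hpB i))
      (mem_flats_of_mem_hyperplanes (hpB j))
    have hN := hloc i j hij
    have hspan := span_sup_ker_inf_ker (hpx i) (hpx j)
    have hYN : Y ≤ LinearMap.ker (p i - p j) := by
      rw [← hspan]
      exact le_sup_right
    have hYk : Y ≤ LinearMap.ker (p k) := by
      intro v hv
      have h1 := heq ▸ hYN hv
      have h2 := LinearMap.mem_ker.1 hv.1
      rw [LinearMap.mem_ker, LinearMap.sub_apply, h2, zero_sub, neg_eq_zero] at h1
      exact h1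
    have hNp : ∀ i', LinearMap.ker (p i') ≠ LinearMap.ker (p i - p j) := by
      intro i' h
      apply hxl i'
      rw [← hpker, h]
      exact hN.2 (Submodule.mem_span_singleton_self x)
    have hsub : ({LinearMap.ker (p i), LinearMap.ker (p j), LinearMap.ker (p k),
        LinearMap.ker (p i - p j)} : Set (Submodule ℝ V)) ⊆ (B.localization Y).hyperplanes := by
      rintro H (rfl | rfl | rfl | rfl)
      · exact ⟨hpB i, inf_le_left⟩
      · exact ⟨hpB j, inf_le_right⟩
      · exact ⟨hpB k, hYk⟩
      · exact ⟨hN.1, hYN⟩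
    have hfour : 3 < ((A2n 3).localization (F.toFun Y)).hyperplanes.ncard := by
      rw [F.ncard_localization hYf]
      have h := Set.ncard_le_ncard hsub (B.localization Y).finite_hyperplanes
      rw [Set.ncard_insert_of_notMem, Set.ncard_insert_of_notMem, Set.ncard_pair (hNp k)] at h
      · omega
      · rintro (h | h)
        · exact hjk (hkerinj _ _ h)
        · exact hNp j h
      · rintro (h | h | h)
        · exact hij (hkerinj _ _ h)
        · exact hik (hkerinj _ _ h)
        · exact hNp i h
    -- Collinear points would put four hyperplanes above `Y`, so its image lies on the axis. With
    -- only three mirrors, one of the four images is a side, which meets the axis in `0`. Then `Y ≤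
    -- X`, so `X` is itself a hyperplane and has only one hyperplane above it.
    obtain ⟨s, hs, hle⟩ : ∃ s < 3, F.toFun Y ≤ side 3 s := by
      by_contra! hno
      have hsub' : ((A2n 3).localization (F.toFun Y)).hyperplanes ⊆
          Set.range (fun k : Fin 3 => mirror 3 k) := by
        rintro H ⟨hH, hle⟩
        rcases mem_A2n.1 hH with ⟨k, hk, rfl⟩ | ⟨s, hs, rfl⟩
        · exact ⟨⟨k, hk⟩, rfl⟩
        · exact absurd hle (hno s hs)
      have h := Set.ncard_le_ncard hsub' (Set.finite_range _)
      rw [Set.ncard_range_of_injective fun a b hab => Fin.ext (mirror_inj a.2 b.2 hab),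
        Nat.card_fin] at h
      omega
    have hbot : F.toFun Y ≤ F.toFun (Submodule.span ℝ {x}) := by
      intro v hv
      obtain ⟨h0, h1⟩ := eq_zero_of_three_lt_ncard hfour hv
      have h2 := mem_side.1 (hle hv)
      rw [h0, h1, mul_zero, mul_zero, zero_add, zero_add] at h2
      have : v = 0 := by
        ext a
        fin_cases a <;> assumption
      rw [this]
      exact zero_mem _
    rw [F.le_iff _ hYf _ hX] at hbot
    rw [sup_eq_left.2 hbot] at hspan
    have h1 : (B.localization (Submodule.span ℝ {x})).hyperplanes.ncard ≤ 1 := by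
      rw [Set.ncard_le_one_iff (B.localization _).finite_hyperplanes]
      have hall : ∀ H ∈ (B.localization (Submodule.span ℝ {x})).hyperplanes,
          H = LinearMap.ker (p i - p j) := by
        intro H hH
        have hle' := hH.2
        rw [hspan] at hle'
        exact ((B.isCoatom_of_mem _ hN.1).le_iff.1 hle').resolve_left
          (B.isCoatom_of_mem _ hH.1).1
      intro H K hH hK
      rw [hall H hH, hall K hK]
    omega
  have hswap : ∀ i j, LinearMap.ker (p i - p j) = LinearMap.ker (p j - p i) := fun i j => by
    ext v
    simp only [LinearMap.mem_ker, LinearMap.sub_apply]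
    exact ⟨fun h => by linarith, fun h => by linarith⟩
  -- In `ℤ/3`, `2s + 1` and `2s + 2` are the two distinct indices with sum `s`.
  set m : ZMod 3 → Submodule ℝ V := fun s => LinearMap.ker (p (2 * s + 1) - p (2 * s + 2)) with hm
  have hker : ∀ i j, i ≠ j → LinearMap.ker (p i - p j) = m (i + j) := by
    intro i j hij
    have h : ∀ i j : ZMod 3, i ≠ j → (2 * (i + j) + 1 = i ∧ 2 * (i + j) + 2 = j) ∨
        (2 * (i + j) + 1 = j ∧ 2 * (i + j) + 2 = i) := by decide
    simp only [hm]
    rcases h i j hij with ⟨h1, h2⟩ | ⟨h1, h2⟩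
    · rw [h1, h2]
    · rw [h1, h2, hswap]
  have hminj : Injective m := by
    intro s t hst
    by_contra hne
    have h : ∀ s t : ZMod 3, s ≠ t → ∃ i j k, i ≠ j ∧ i ≠ k ∧ j ≠ k ∧ i + j = s ∧ i + k = t := by
      decide
    obtain ⟨i, j, k, hij, hik, hjk, rfl, rfl⟩ := h s t hne
    rw [← hker i j hij, ← hker i k hik] at hst
    exact hnc i j k hij hik hjk hst
  refine ⟨⟨p, m, hpinj, hminj, hpx, hpB, ?_, hker⟩⟩
  apply Set.eq_of_subset_of_ncard_le
  · rintro _ ⟨s, rfl⟩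
    exact hloc _ _ (by revert s; decide)
  · rw [hcard, Set.ncard_range_of_injective hminj, Nat.card_zmod]
  · exact (B.localization _).finite_hyperplanes

namespace Labelling

/-- The labelled hyperplanes through the line and off it are `n + n` distinct ones, so they exhaust
`B`. -/
theorem hyperplane_cases [NeZero n] (L : Labelling B x n) (hcard : B.hyperplanes.ncard = 2 * n)
    {H : Submodule ℝ V} (hH : H ∈ B.hyperplanes) :
    H ∈ Set.range L.m ∨ ∃ i, LinearMap.ker (L.p i) = H := by
  have hkinj : Injective fun i => LinearMap.ker (L.p i) := fun i j hij =>
    L.p_injective (dual_eq_of_ker_eq (L.p_apply i) (L.p_apply j) hij)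
  have h : Set.range L.m ∪ Set.range (fun i => LinearMap.ker (L.p i)) = B.hyperplanes := by
    apply Set.eq_of_subset_of_ncard_le
    · rintro K (hK | ⟨i, rfl⟩)
      · rw [L.range_m] at hK
        exact hK.1
      · exact L.ker_mem i
    · rw [hcard, Set.ncard_union_eq ?_ (Set.finite_range _) (Set.finite_range _),
        Set.ncard_range_of_injective L.m_injective, Set.ncard_range_of_injective hkinj,
        Nat.card_zmod, two_mul]
      rw [Set.disjoint_left]
      rintro K hK ⟨i, rfl⟩
      rw [L.range_m] at hK
      have := LinearMap.mem_ker.1 (hK.2 (Submodule.mem_span_singleton_self x))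
      rw [L.p_apply i] at this
      exact one_ne_zero this
    · exact B.finite_hyperplanes
  rw [← h] at hH
  exact hH

theorem exists_ne_add_eq (hn : 3 ≤ n) (s : ZMod n) : ∃ j k, j ≠ k ∧ j + k = s := by
  by_cases h : s + 1 = -1
  · refine ⟨s + 2, -2, fun h' => ?_, by ring⟩
    have h2 : ((2 : ℕ) : ZMod n) = 0 := by push_cast; linear_combination h' - h
    rw [ZMod.natCast_eq_zero_iff] at h2
    exact absurd (Nat.le_of_dvd two_pos h2) (by omega)
  · exact ⟨s + 1, -1, h, by ring⟩

theorem exists_addChar [NeZero n] (hn : 3 ≤ n) (L : Labelling B x n) :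
    ∃ (ψ : AddChar (ZMod n) ℂ) (c : Dual ℝ V) (G : ℂ →ₗ[ℝ] Dual ℝ V),
      Injective ψ ∧ Injective G ∧ ∀ i, L.p i = c + G (ψ i) := by
  have hne1 : (1 : ZMod n) ≠ 0 := by
    have : Fact (1 < n) := ⟨by omega⟩
    exact one_ne_zero
  have hne2 : (2 : ZMod n) ≠ 0 := by
    intro h
    have : ((2 : ℕ) : ZMod n) = 0 := by exact_mod_cast h
    rw [ZMod.natCast_eq_zero_iff] at this
    exact absurd (Nat.le_of_dvd two_pos this) (by omega)
  refine exists_addChar_of_parallel hn L.p L.p_injective ?_ ?_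
  · intro i j k l hkl hsum
    by_cases hij : i = j
    · exact ⟨0, by rw [hij, sub_self, zero_smul]⟩
    · exact exists_eq_smul_of_ker_le (by rw [L.ker_sub i j hij, L.ker_sub k l hkl, hsum])
  · intro i
    -- Consecutive edges carry the labels `2i + 1` and `2i + 3`, which differ since `2 ≠ 0`.
    have h1 : i + 1 ≠ i := fun h => hne1 (by linear_combination h)
    have h2 : i + 2 ≠ i + 1 := fun h => hne1 (by linear_combination h)
    have hx := sub_ne_zero.2 fun h => h1 (L.p_injective h)
    have hy := sub_ne_zero.2 fun h => h2 (L.p_injective h)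
    rw [LinearIndependent.pair_iff' hx]
    intro a ha
    have ha0 : a ≠ 0 := by
      rintro rfl
      rw [zero_smul] at ha
      exact hy ha.symm
    have hk : L.m (i + 2 + (i + 1)) = L.m (i + 1 + i) := by
      rw [← L.ker_sub _ _ h2, ← L.ker_sub _ _ h1, ← ha, LinearMap.ker_smul _ _ ha0]
    exact hne2 (by linear_combination L.m_injective hk)

/-- A further functional whose differences with all `p i` have labelled kernels is the centre. -/
theorem eq_center_and_even [NeZero n] (hn : 3 ≤ n) (L : Labelling B x n)
    {ψ : AddChar (ZMod n) ℂ} {c : Dual ℝ V} {G : ℂ →ₗ[ℝ] Dual ℝ V} (hψ : Injective ψ)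
    (hG : Injective G) (hp : ∀ i, L.p i = c + G (ψ i)) {q : Dual ℝ V} (hq : ∀ i, q ≠ L.p i)
    (hker : ∀ i, LinearMap.ker (q - L.p i) ∈ Set.range L.m) : q = c ∧ Even n := by
  choose f hf using hker
  have hdir : ∀ i, ∃ (t : ℝ) (j k : ZMod n), j + k = f i ∧ q - L.p i = t • (L.p j - L.p k) := by
    intro i
    obtain ⟨j, k, hjk, hs⟩ := exists_ne_add_eq hn (f i)
    obtain ⟨t, ht⟩ := exists_eq_smul_of_ker_le
      (f := q - L.p i) (g := L.p j - L.p k) (by rw [L.ker_sub j k hjk, hs, hf])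
    exact ⟨t, j, k, hs, ht⟩
  have hsub : ∀ j k, L.p j - L.p k = G (ψ j - ψ k) := fun j k => by
    rw [hp, hp, map_sub]; abel
  -- `q` differs from the vertex `p 0` by a multiple of a chord, so it lies in the plane of the
  -- polygon.
  obtain ⟨w, hw⟩ : ∃ w, q = c + G w := by
    obtain ⟨t, j, k, -, ht⟩ := hdir 0
    refine ⟨ψ 0 + t • (ψ j - ψ k), ?_⟩
    rw [map_add, map_smul, ← hsub, ← ht, ← add_assoc, ← hp]
    abel
  -- The line from `p i` in direction `f i` passes through `q` and, if it is another vertex, through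
  -- `p (f i - i)`. Seen from that vertex, `q` lies in the same direction.
  have hinv : ∀ i, f (f i - i) = f i := by
    intro i
    by_cases hgi : f i - i = i
    · rw [hgi]
    · apply L.m_injective
      have h1 : LinearMap.ker (L.p i - L.p (f i - i)) = L.m (f i) := by
        rw [L.ker_sub i _ (Ne.symm hgi)]
        congr 1
        ring
      obtain ⟨t, ht⟩ := exists_eq_smul_of_ker_le
        (f := L.p i - L.p (f i - i)) (g := q - L.p i) (by rw [h1, hf])
      have hle : LinearMap.ker (q - L.p i) ≤ LinearMap.ker (q - L.p (f i - i)) := by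
        intro v hv
        have e : q - L.p (f i - i) = (1 + t) • (q - L.p i) := by
          rw [add_smul, ← ht, one_smul]; abel
        rw [LinearMap.mem_ker, e, LinearMap.smul_apply, LinearMap.mem_ker.1 hv, smul_zero]
      rw [hf, hf]
      have c1 := isCoatom_ker_of_ne_zero (sub_ne_zero.2 (hq i))
      have c2 := isCoatom_ker_of_ne_zero (sub_ne_zero.2 (hq (f i - i)))
      exact (c1.le_iff.1 hle).resolve_left c2.1
  obtain ⟨hw0, heven⟩ := eq_zero_and_even_of_directions hn hψ (w := w) (f := f) (fun i => by
    obtain ⟨t, j, k, hs, ht⟩ := hdir i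
    refine ⟨t, j, k, hs, ?_⟩
    apply hG
    rw [← Complex.real_smul, map_smul, ← hsub, ← ht, hw, hp, map_sub]
    abel) hinv
  refine ⟨?_, heven⟩
  rw [hw, hw0, map_zero, add_zero]

end Labelling

end Labelling

end Arrangement

namespace Arrangement

open Module Function

/-! ### Coordinates in `ℝ³` -/

section Coordinates

variable {V : Type*} [AddCommGroup V] [Module ℝ V]

/-- The linear map `V → ℝ³` with coordinate functionals `G 1`, `G I`, `c`. -/
noncomputable def coordMap (G : ℂ →ₗ[ℝ] Dual ℝ V) (c : Dual ℝ V) : V →ₗ[ℝ] (Fin 3 → ℝ) :=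
  LinearMap.pi ![G 1, G Complex.I, c]

theorem comap_coordMap_perp (G : ℂ →ₗ[ℝ] Dual ℝ V) (c : Dual ℝ V) (z : ℂ) (t : ℝ) :
    (perp ![z.re, z.im, t]).comap (coordMap G c) = LinearMap.ker (G z + t • c) := by
  have hz : G z = z.re • G 1 + z.im • G Complex.I := by
    rw [← map_smul, ← map_smul, ← map_add]
    congr 1
    exact Complex.ext (by simp) (by simp)
  ext v
  rw [Submodule.mem_comap, mem_perp, LinearMap.mem_ker, hz]
  simp [coordMap]

/-- `exp (i π m / n)`. -/
noncomputable def unitN (n m : ℕ) : ℂ := ⟨cosN n m, sinN n m⟩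

theorem unitN_eq_exp (n m : ℕ) : unitN n m = Complex.exp (m * (Real.pi / n) * Complex.I) := by
  have e : (m * (Real.pi / n) : ℂ) = ((m * (Real.pi / n) : ℝ) : ℂ) := by push_cast; rfl
  rw [e]
  apply Complex.ext
  · rw [Complex.exp_ofReal_mul_I_re, ← cosN_eq, unitN]
  · rw [Complex.exp_ofReal_mul_I_im, ← sinN_eq, unitN]

theorem exists_unitN_mul_eq {n : ℕ} [NeZero n] (ψ : AddChar (ZMod n) ℂ) (i : ZMod n) :
    ∃ a < n, unitN n 1 * ψ i = unitN n (2 * a + 1) := by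
  have hpow : ψ i ^ n = 1 := by
    rw [← AddChar.map_nsmul_eq_pow, nsmul_eq_mul, ZMod.natCast_self, zero_mul,
      AddChar.map_zero_eq_one]
  obtain ⟨a, ha, h⟩ := (Complex.isPrimitiveRoot_exp n (NeZero.ne n)).eq_pow_of_pow_eq_one hpow
  refine ⟨a, ha, ?_⟩
  rw [← h, unitN_eq_exp, unitN_eq_exp, ← Complex.exp_nat_mul, ← Complex.exp_add]
  congr 1
  push_cast
  ring

/-- Sum-to-product formulas: a chord of the polygon is a multiple of the normal of a mirror. -/
theorem unitN_sub_unitN (n a b : ℕ) : unitN n (2 * a + 1) - unitN n (2 * b + 1) =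
    (2 * Real.sin (((a : ℝ) - b) * (Real.pi / n))) •
      (⟨-sinN n (a + b + 1), cosN n (a + b + 1)⟩ : ℂ) := by
  set s := ((a : ℝ) + b + 1) * (Real.pi / n) with hsdef
  set d := ((a : ℝ) - b) * (Real.pi / n) with hd
  have e1 : ((2 * a + 1 : ℕ) : ℝ) * (Real.pi / n) = s + d := by
    rw [hsdef, hd]; push_cast; ring
  have e2 : ((2 * b + 1 : ℕ) : ℝ) * (Real.pi / n) = s - d := by
    rw [hsdef, hd]; push_cast; ring
  have e3 : ((a + b + 1 : ℕ) : ℝ) * (Real.pi / n) = s := by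
    rw [hsdef]; push_cast; ring
  apply Complex.ext
  · simp only [unitN, cosN_eq, sinN_eq, e1, e2, e3, Complex.sub_re, Complex.smul_re, smul_eq_mul,
      Real.cos_add, Real.cos_sub]
    ring
  · simp only [unitN, cosN_eq, sinN_eq, e1, e2, e3, Complex.sub_im, Complex.smul_im, smul_eq_mul,
      Real.sin_add, Real.sin_sub]
    ring

end Coordinates

/-! ### Identification with `A(4m+1,1)` -/

section Main

variable {V : Type*} [AddCommGroup V] [Module ℝ V] {A B : Arrangement V} {x : V} {n : ℕ}

/-- Adding the centre to a labelled arrangement gives, up to a linear isomorphism, the arrangement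
`A(4m+1,1)`. -/
theorem Labelling.latticeEquiv_A4mAddOne [NeZero n] (hn : Even n) (hV : finrank ℝ V = 3)
    (hX : Submodule.span ℝ {x} ∈ B.flats) (L : Labelling B x n)
    (hcard : B.hyperplanes.ncard = 2 * n) {ψ : AddChar (ZMod n) ℂ} {c : Dual ℝ V}
    {G : ℂ →ₗ[ℝ] Dual ℝ V} (hp : ∀ i, L.p i = c + G (ψ i))
    (hn3 : 3 ≤ n) (hc : LinearMap.ker c ∉ B.hyperplanes)
    (hA : A.hyperplanes = insert (LinearMap.ker c) B.hyperplanes) :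
    A.LatticeEquiv (A4mAddOne (n / 2)) := by
  have hη : unitN n 1 ≠ 0 := by
    rw [unitN_eq_exp]
    exact Complex.exp_ne_zero _
  -- The values of `ψ` are `n`-th roots of unity, while the sides of `A(2n,1)` sit at odd multiples
  -- of `π / n`; the rotation by `π / n` matches them.
  set G' : ℂ →ₗ[ℝ] Dual ℝ V := G ∘ₗ LinearMap.mulLeft ℝ (unitN n 1)⁻¹ with hG'
  have hGG' : ∀ z, G z = G' (unitN n 1 * z) := fun z => by
    simp [hG', hη]
  have hn2 : 2 * (n / 2) = n := Nat.two_mul_div_two_of_even hn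
  have hpa : ∀ i, ∃ a < n, L.p i = c + G' (unitN n (2 * a + 1)) := by
    intro i
    obtain ⟨a, ha, h⟩ := exists_unitN_mul_eq ψ i
    exact ⟨a, ha, by rw [hp, hGG', h]⟩
  have hside : ∀ i, ∃ H ∈ (A2n n).hyperplanes,
      H.comap (coordMap G' c) = LinearMap.ker (L.p i) := by
    intro i
    obtain ⟨a, ha, h⟩ := hpa i
    refine ⟨side n a, side_mem_A2n ha, ?_⟩
    have := comap_coordMap_perp G' c (unitN n (2 * a + 1)) 1
    rw [one_smul, add_comm (G' _), ← h] at this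
    exact this
  have hmir : ∀ s, ∃ H ∈ (A2n n).hyperplanes, H.comap (coordMap G' c) = L.m s := by
    intro s
    obtain ⟨j, k, hjk, rfl⟩ := Labelling.exists_ne_add_eq hn3 s
    obtain ⟨a, ha, hja⟩ := hpa j
    obtain ⟨b, hb, hkb⟩ := hpa k
    have hab : a ≠ b := by
      rintro rfl
      exact hjk (L.p_injective (hja.trans hkb.symm))
    refine ⟨mirror n (a + b + 1), mirror_mem_A2n (NeZero.ne n) _, ?_⟩
    have := comap_coordMap_perp G' c ⟨-sinN n (a + b + 1), cosN n (a + b + 1)⟩ 0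
    rw [zero_smul, add_zero] at this
    rw [← L.ker_sub j k hjk, hja, hkb, add_sub_add_left_eq_sub, ← map_sub, unitN_sub_unitN,
      map_smul, LinearMap.ker_smul _ _ (mul_ne_zero two_ne_zero (sin_ne_zero_of_lt ha hb hab))]
    exact this
  -- A vector of the kernel lies in all labelled hyperplanes. Those through `x` cut out the line of
  -- `x`, and `p 0` does not vanish at `x`.
  have hinj : Injective (coordMap G' c) := by
    rw [← LinearMap.ker_eq_bot, LinearMap.ker_eq_bot']
    intro v hv
    have hall : ∀ K, (∃ H ∈ (A2n n).hyperplanes, H.comap (coordMap G' c) = K) → v ∈ K := by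
      rintro _ ⟨H, -, rfl⟩
      rw [Submodule.mem_comap, hv]
      exact zero_mem _
    have hvx : v ∈ Submodule.span ℝ {x} := by
      rw [← sInf_localization hX, ← L.range_m, Submodule.mem_sInf]
      rintro _ ⟨s, rfl⟩
      exact hall _ (hmir s)
    obtain ⟨t, rfl⟩ := Submodule.mem_span_singleton.1 hvx
    have := LinearMap.mem_ker.1 (hall _ (hside 0))
    rw [map_smul, L.p_apply, smul_eq_mul, mul_one] at this
    rw [this, zero_smul]
  have : FiniteDimensional ℝ V := FiniteDimensional.of_finrank_pos (by omega)
  let φ : V ≃ₗ[ℝ] (Fin 3 → ℝ) :=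
    LinearEquiv.ofInjectiveOfFinrankEq (coordMap G' c) hinj (by simp [hV])
  have hφ : (φ : V →ₗ[ℝ] (Fin 3 → ℝ)) = coordMap G' c := rfl
  refine latticeEquiv_of_linearEquiv φ ?_
  rw [hφ]
  have hA4 : (A4mAddOne (n / 2)).hyperplanes = insert (perp ![0, 0, 1]) (A2n n).hyperplanes := by
    change insert _ (A2n (2 * (n / 2))).hyperplanes = _
    rw [hn2]
  -- One inclusion suffices, since `A` has `2n + 1` hyperplanes and `A(4m+1,1)` at most that many.
  apply Set.eq_of_subset_of_ncard_le
  · rw [hA, hA4]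
    rintro K (rfl | hK)
    · refine ⟨perp ![0, 0, 1], Set.mem_insert _ _, ?_⟩
      have := comap_coordMap_perp G' c 0 1
      rwa [map_zero, zero_add, one_smul] at this
    · have h : ∃ H ∈ (A2n n).hyperplanes, H.comap (coordMap G' c) = K := by
        rcases L.hyperplane_cases hcard hK with ⟨s, rfl⟩ | ⟨i, rfl⟩
        · exact hmir s
        · exact hside i
      obtain ⟨H, hH, rfl⟩ := h
      exact ⟨H, Set.mem_insert_of_mem _ hH, rfl⟩
  · rw [hA, Set.ncard_insert_of_notMem hc B.finite_hyperplanes, hcard]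
    refine (Set.ncard_image_le (A4mAddOne (n / 2)).finite_hyperplanes).trans ?_
    rw [hA4]
    refine (Set.ncard_insert_le _ _).trans ?_
    rw [ncard_A2n]
  · exact (A4mAddOne (n / 2)).finite_hyperplanes.image _

end Main

end Arrangement

/-! ### Assembling the proof -/

theorem Arrangement.exists_span_singleton_eq {V : Type*} [AddCommGroup V] [Module ℝ V]
    (hV : Module.finrank ℝ V = 3) {X : Submodule ℝ V} (hX : Module.finrank ℝ (V ⧸ X) = 2) :
    ∃ x : V, x ≠ 0 ∧ Submodule.span ℝ {x} = X := by
  have : FiniteDimensional ℝ V := Module.finite_of_finrank_pos (by omega)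
  have h1 : Module.finrank ℝ X = 1 := by
    have := Submodule.finrank_quotient_add_finrank X
    omega
  obtain ⟨⟨x, hxX⟩, hx0, hx⟩ := finrank_eq_one_iff'.1 h1
  refine ⟨x, fun h => hx0 (Subtype.ext h), le_antisymm ?_ ?_⟩
  · rwa [Submodule.span_singleton_le_iff_mem]
  · intro v hv
    obtain ⟨t, ht⟩ := hx ⟨v, hv⟩
    exact Submodule.mem_span_singleton.2 ⟨t, congrArg Subtype.val ht⟩

theorem Arrangement.two_le_ncard_localization {V : Type*} [AddCommGroup V] [Module ℝ V]
    {A : Arrangement V} {X : Submodule ℝ V} (hX : X ∈ A.flatsOfRank 2) :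
    2 ≤ (A.localization X).hyperplanes.ncard := by
  by_contra! h
  have hinf := sInf_localization hX.1
  have hrank := hX.2
  rcases (Set.ncard_le_one_iff_eq (A.localization X).finite_hyperplanes).1 (by omega) with h | ⟨H, h⟩
  · rw [h, sInf_empty] at hinf
    rw [← hinf, Module.finrank_zero_of_subsingleton] at hrank
    omega
  · have hH : H ∈ (A.localization X).hyperplanes := by simp [h]
    rw [h, sInf_singleton] at hinf
    subst hinf
    have := isSimpleModule_iff_isCoatom.2 (A.isCoatom_of_mem H hH.1)
    rw [isSimpleModule_iff_finrank_eq_one.1 this] at hrank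
    omega

open Module in
/-- The hyperplanes of an irreducible arrangement outside `B` are all equal to one hyperplane `J`;
if there are any, then `n` is even and `B ∪ {J}` is lattice equivalent to `A(4(n/2)+1,1)`. -/
theorem Arrangement.exists_center {V : Type*} [AddCommGroup V] [Module ℝ V]
    (hV : finrank ℝ V = 3) (A : Arrangement V) (hirr : A.IsIrreducible)
    (X : Submodule ℝ V) (hX : X ∈ A.flatsOfRank 2) (hmod : A.IsModular X)
    (n : ℕ) (hn : n = (A.localization X).hyperplanes.ncard)
    (B : Arrangement V) (hBA : B.hyperplanes ⊆ A.hyperplanes)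
    (hBX : A.localization X = B.localization X) (hB : B.LatticeEquiv (A2n n)) :
    ∃ C : Submodule ℝ V, ∀ J ∈ A.hyperplanes \ B.hyperplanes, J = C ∧ Even n ∧
      (A.hyperplanes = insert J B.hyperplanes → A.LatticeEquiv (A4mAddOne (n / 2))) := by
  have hn2 : 2 ≤ n := hn ▸ two_le_ncard_localization hX
  have : NeZero n := ⟨by omega⟩
  obtain ⟨x, hx0, rfl⟩ := exists_span_singleton_eq hV hX.2
  have hBcard : B.hyperplanes.ncard = 2 * n := by
    obtain ⟨F⟩ := hB.nonempty_flatCorrespondence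
    rw [← F.ncard_hyperplanes, ncard_A2n]
  have hJx : ∀ J ∈ A.hyperplanes \ B.hyperplanes, x ∉ J := by
    rintro J ⟨hJA, hJB⟩ hxJ
    have h : J ∈ (A.localization (Submodule.span ℝ {x})).hyperplanes :=
      ⟨hJA, (Submodule.span_singleton_le_iff_mem _ _).2 hxJ⟩
    rw [hBX] at h
    exact hJB h.1
  have hXB : Submodule.span ℝ {x} ∈ B.flats := by
    refine ⟨(B.localization (Submodule.span ℝ {x})).hyperplanes, fun H hH => hH.1, ?_⟩
    rw [← hBX, sInf_localization hX.1]
  have hcard : (B.localization (Submodule.span ℝ {x})).hyperplanes.ncard = n := by rw [← hBX, ← hn]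
  rcases hn2.eq_or_lt with h2 | h3
  -- For `n = 2` no such `J` exists, so `⊥` is a dummy. Since `B` has four hyperplanes and only two
  -- contain `x`, some `K` in `B` avoids `x`; together with `J` it makes `A` reducible.
  · refine ⟨⊥, fun J hJ => (hirr ?_).elim⟩
    obtain ⟨M, N, hMN, hloc⟩ := Set.ncard_eq_two.1 (hn.symm.trans h2.symm)
    obtain ⟨K, hKB, hK⟩ : ∃ K ∈ B.hyperplanes, x ∉ K := by
      by_contra! hall
      have hsub : B.hyperplanes ⊆ (B.localization (Submodule.span ℝ {x})).hyperplanes :=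
        fun H hH => ⟨hH, (Submodule.span_singleton_le_iff_mem _ _).2 (hall H hH)⟩
      have := Set.ncard_le_ncard hsub (B.localization _).finite_hyperplanes
      omega
    obtain ⟨h, rfl, hx⟩ := exists_dual_ker_eq (A.isCoatom_of_mem J hJ.1) (hJx J hJ)
    obtain ⟨k, rfl, kx⟩ := exists_dual_ker_eq (B.isCoatom_of_mem K hKB) hK
    refine hmod.isReducible_of_pair hx0 hMN hloc hJ.1 (hBA hKB) hx kx ?_
    rintro rfl
    exact hJ.2 hKB
  · obtain ⟨L⟩ : Nonempty (Labelling B x n) := by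
      rcases (show 3 ≤ n from h3).eq_or_lt with rfl | h4
      · refine nonempty_labelling_of_eq_three hXB (fun h k hh hk hx kx hne => ?_) hcard hB
        rw [← hBX]
        exact hmod.ker_sub_mem (hBA hh) (hBA hk) hx kx hne
      · exact nonempty_labelling_of_three_lt h4 hXB hcard hB
    obtain ⟨ψ, c, G, hψ, hG, hp⟩ := L.exists_addChar h3
    refine ⟨LinearMap.ker c, fun J hJ => ?_⟩
    obtain ⟨q, rfl, hq⟩ := exists_dual_ker_eq (A.isCoatom_of_mem J hJ.1) (hJx J hJ)
    have hqp : ∀ i, q ≠ L.p i := by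
      rintro i rfl
      exact hJ.2 (L.ker_mem i)
    obtain ⟨rfl, heven⟩ := L.eq_center_and_even h3 hψ hG hp hqp fun i => by
      rw [L.range_m, ← hBX]
      exact hmod.ker_sub_mem hJ.1 (hBA (L.ker_mem i)) hq (L.p_apply i) (hqp i)
    exact ⟨rfl, heven, fun hA => L.latticeEquiv_A4mAddOne heven hV hXB hBcard hp h3 hJ.2 hA⟩

theorem mainTheorem9 {V : Type*} [NormedAddCommGroup V] [NormedSpace ℝ V]
    (hV : Module.finrank ℝ V = 3)
    (A : Arrangement V) (hirr : A.IsIrreducible) (hss : A.IsSupersolvable)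
    (hsimp : A.IsSimplicial)
    (X : Submodule ℝ V) (hX : X ∈ A.flatsOfRank 2) (hmod : A.IsModular X)
    (n : ℕ) (hn : n = (A.localization X).hyperplanes.ncard)
    (B : Arrangement V) (hBA : B.hyperplanes ⊆ A.hyperplanes)
    (hBX : A.localization X = B.localization X)
    (hB : B.LatticeEquiv (Arrangement.A2n n)) :
    (A.hyperplanes \ B.hyperplanes).ncard ≤ 1 ∧
    (∀ J : Submodule ℝ V, J ∉ B.hyperplanes → A.hyperplanes = insert J B.hyperplanes →
      Even n ∧ A.LatticeEquiv (Arrangement.A4mAddOne (n / 2))) := by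
  obtain ⟨C, hC⟩ := Arrangement.exists_center hV A hirr X hX hmod n hn B hBA hBX hB
  constructor
  · rw [Set.ncard_le_one_iff (A.finite_hyperplanes.subset Set.sdiff_subset)]
    intro J K hJ hK
    rw [(hC J hJ).1, (hC K hK).1]
  · intro J hJ hA
    obtain ⟨-, heven, h⟩ := hC J ⟨hA ▸ Set.mem_insert _ _, hJ⟩
    exact ⟨heven, h hA⟩
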